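/- Notation. For $a,b\in\mathbb Q^\times$ let $$S_{a,b}=\{2x_1 : x_1,x_2,x_3,x_4\in\mathbb Q,\ x_1^2-ax_2^2-bx_3^2+abx_4^2=1\},\qquad T_{a,b}=S_{a,b}+S_{a,b},$$ where sums of sets are sumsets $A+B=\{x+y: x\in A,\ y\in B\}$. For $p,q\in\mathbb Q^\times$ let $$R_p^{[3]}=T_{-p,-p}+T_{2p,-p},\quad R_p^{[5]}=T_{-2p,-p}+T_{2p,-p},\quad R_p^{[7]}=T_{-p,-p}+T_{2p,p},\quad R_{p,q}^{[1]}=T_{2pq,q}+T_{-2pq,q}.$$ For a prime $l$ let $v_l$ be the $l$-adic valuation on $\mathbb Q$ and $\mathbb Z_{(l)}\subseteq\mathbb Q$ the ring of rationals $m/n$ with $m,n\in\mathbb Z$, $l\nmid n$. An intersection of rings $\mathbb Z_{(l)}$ over the empty set of primes is $\mathbb Q$. For $a\in\mathbb Q^\times$ let $\left(\!\left(\frac{a}{l}\right)\!\right)$ be $1$ if the $l$-adic unit $a\,l^{-v_l(a)}$ is a square modulo $l$, and $-1$ otherwise. For $p\in\mathbb Q^\times$ let $\mathbb P(p)$ be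 the set of primes $l$ with $v_l(p)$ odd, and $\mathbb P^{[k]}(p)=\{l\in\mathbb P(p): l\equiv k \bmod 8\}$. Write $p\equiv_2 k \bmod 8$ if $p\in k+8\mathbb Z_{(2)}$. Proposition. (a) $\mathbb Z_{(2)}=T_{3,3}+T_{2,5}$. (b) Let $k\in\{3,5,7\}$ and $p\in\mathbb Q^\times$. If $p\equiv_2 k\bmod 8$, then $R_p^{[k]}=\bigcap_{l\in\mathbb P^{[k]}(p)}\mathbb Z_{(l)}$. Otherwise $R_p^{[k]}$ is $\bigcap_{l\in\mathbb P^{[k]}(p)}\mathbb Z_{(l)}$ or $\bigcap_{l\in\mathbb P^{[k]}(p)\cup\{2\}}\mathbb Z_{(l)}$. In particular, if $p$ is a prime with $p\equiv k\bmod 8$, then $\mathbb Z_{(p)}=R_p^{[k]}$. (c) Let $p,q\in\mathbb Q^\times$ with $p\equiv_2 1\bmod 8$ and $q\equiv_2 3\bmod 8$. Then $R_{p,q}^{[1]}=\bigcap_{l\in\mathbb P(p,q)}\mathbb Z_{(l)}$ (which is $\mathbb Q$ if $\mathbb P(p,q)=\emptyset$), where $\mathbb P(p,q)$ is the set of primes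 $l$ satisfying one of the following: - $l\in\mathbb P(p)\setminus\mathbb P(q)$ and $\left(\!\left(\frac{q}{l}\right)\!\right)=-1$; - $l\in\mathbb P(q)\setminus\mathbb P(p)$ and $\left(\!\left(\frac{2p}{l}\right)\!\right)=\left(\!\left(\frac{-2p}{l}\right)\!\right)=-1$; - $l\in\mathbb P(p)\cap\mathbb P(q)$ and $\left(\!\left(\frac{2pq}{l}\right)\!\right)=\left(\!\left(\frac{-2pq}{l}\right)\!\right)=-1$. In particular, if $p$ is a prime with $p\equiv 1\bmod 8$ and $q$ is a prime with $q\equiv 3\bmod 8$ whose Legendre symbol $\left(\frac pq\right)$ is $-1$, then $\mathbb Z_{(p)}=R_{p,q}^{[1]}$. -/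

import Mathlib

namespace LocalRings

open scoped Pointwise

/-- The traces `2 x₁` of the norm-one elements of the quaternion algebra over `ℚ` with
`α² = a`, `β² = b`, `αβ = -βα`. -/
def S (a b : ℚ) : Set ℚ :=
  {s | ∃ x₁ x₂ x₃ x₄ : ℚ,
    x₁ ^ 2 - a * x₂ ^ 2 - b * x₃ ^ 2 + a * b * x₄ ^ 2 = 1 ∧ s = 2 * x₁}

/-- `T a b = S a b + S a b` (sumset). -/
def T (a b : ℚ) : Set ℚ := S a b + S a b

/-- The ring `ℤ_(l)` of rationals that can be written with denominator prime to the prime `l`. -/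
def Zloc (l : ℕ) : Set ℚ :=
  {x | ∃ m n : ℤ, ¬ (l : ℤ) ∣ n ∧ x = (m : ℚ) / (n : ℚ)}

def R3 (p : ℚ) : Set ℚ := T (-p) (-p) + T (2 * p) (-p)

def R5 (p : ℚ) : Set ℚ := T (-2 * p) (-p) + T (2 * p) (-p)

def R7 (p : ℚ) : Set ℚ := T (-p) (-p) + T (2 * p) p

def R1 (p q : ℚ) : Set ℚ := T (2 * p * q) q + T (-2 * p * q) q

/-- The primes `l` at which `p` has odd valuation. -/
def oddPrimes (p : ℚ) : Set ℕ := {l | l.Prime ∧ Odd (padicValRat l p)}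

/-- The primes `l ≡ k mod 8` at which `p` has odd valuation. -/
def oddPrimesMod (k : ℕ) (p : ℚ) : Set ℕ := {l | l ∈ oddPrimes p ∧ l ≡ k [MOD 8]}

/-- `p ≡₂ k mod 8`, that is, `p ∈ k + 8 ℤ_(2)`. -/
def ModEqTwo (k : ℕ) (p : ℚ) : Prop := ∃ z ∈ Zloc 2, p = (k : ℚ) + 8 * z

open Classical in
/-- The generalized Legendre symbol of a nonzero rational `a` at a prime `l`: it is `1` if the
`l`-adic unit `a * l ^ (-v_l(a))` is a square modulo `l`, and `-1` otherwise. -/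
noncomputable def genLegendre (a : ℚ) (l : ℕ) : ℤ :=
  if ∃ y : ℤ, ∃ z ∈ Zloc l,
      a * (l : ℚ) ^ (-padicValRat l a) = (y : ℚ) ^ 2 + (l : ℚ) * z then 1 else -1

/-- The set `ℙ(p, q)` of primes. -/
def primesPQ (p q : ℚ) : Set ℕ :=
  {l | (l ∈ oddPrimes p \ oddPrimes q ∧ genLegendre q l = -1) ∨
    (l ∈ oddPrimes q \ oddPrimes p ∧
      genLegendre (2 * p) l = -1 ∧ genLegendre (-2 * p) l = -1) ∨
    (l ∈ oddPrimes p ∩ oddPrimes q ∧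
      genLegendre (2 * p * q) l = -1 ∧ genLegendre (-2 * p * q) l = -1)}

end LocalRings

open scoped Pointwise

/-!
Scaling by squares brings `a` and `b` to the form `A * B` and `A * C` with `A`, `B`, `C`
squarefree and coprime. The set `T a b` lies in `ℤ_(l)` for each ramified prime `l`, since the norm
form is anisotropic over `ℚ_l`. Conversely, `r / n` is the trace of a norm-one element as soon as
`r ^ 2 - 4 * n ^ 2` is a value of `A * B * x ^ 2 + A * C * y ^ 2 - B * C * z ^ 2`, the norm form on
trace-zero elements up to sign. The Hasse principle for this representation comes from two
applications of Legendre's theorem linked by an auxiliary prime from Dirichlet's theorem, quadratic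
reciprocity supplying the last local condition. Hence it is enough that `r ^ 2 - 4 * n ^ 2` be
negative if the algebra is ramified at `∞` and, at the primes dividing `2 * A * B * C`, be an
unramified nonsquare or a square according as the algebra is ramified there or not.

Given `t` integral at the ramified primes (and small if `∞` is ramified), write `t = t₀ / n` with
`n` divisible by the unramified primes among the divisors of `2 * A * B * C`. By counting over
finite fields and the Chinese remainder theorem there is an `r` such that both `r` and `t₀ - r`
satisfy these conditions, so that `t` lies in `T a b`. Partial fractions then show that the sum of
two such sets, for two algebras not both ramified at `∞`, is the intersection of the `ℤ_(l)` over
the primes `l` at which both algebras ramify. It remains to read off the ramification of the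
algebras `(m, ±p)` with `m ∈ {-1, 2, -2}` and `(±2pq, q)`.
-/

namespace LocalRings

section LegendreTheorem

lemma isSquare_zmod_of_squarefree {a : ℤ} {n : ℕ} (hn : Squarefree n)
    (h : ∀ l : ℕ, l.Prime → l ∣ n → IsSquare (a : ZMod l)) : IsSquare (a : ZMod n) := by
  induction n using induction_on_primes with
  | zero => exact absurd hn not_squarefree_zero
  | one => exact ⟨0, Subsingleton.elim _ _⟩
  | prime_mul p m hp ih =>
    have hm : IsSquare (a : ZMod m) :=
      ih (hn.squarefree_of_dvd (dvd_mul_left _ _)) fun l hl hd => h l hl (hd.mul_left _)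
    have hprod : IsSquare (a : ZMod p × ZMod m) := by
      obtain ⟨r, hr⟩ := h p hp (dvd_mul_right _ _)
      obtain ⟨s, hs⟩ := hm
      exact ⟨(r, s), Prod.ext hr hs⟩
    let e := ZMod.chineseRemainder (Nat.coprime_of_squarefree_mul hn)
    simpa only [map_intCast] using hprod.map e.symm

/-- Siegel's lemma in the form used by Thue: a box with more lattice points than the target group
has elements contains two points with the same image. -/
lemma exists_ne_zero_abs_le_map_eq_zero {ι G : Type*} [Fintype ι] [AddCommGroup G] [Fintype G]
    (f : (ι → ℤ) →+ G) (B : ι → ℕ) (h : Fintype.card G < ∏ i, (B i + 1)) :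
    ∃ v : ι → ℤ, v ≠ 0 ∧ (∀ i, |v i| ≤ B i) ∧ f v = 0 := by
  classical
  let box : Finset (ι → ℕ) := Fintype.piFinset fun i => Finset.range (B i + 1)
  have hcard : (Finset.univ : Finset G).card < box.card := by
    simpa [box, Fintype.card_piFinset] using h
  obtain ⟨v, hv, w, hw, hne, heq⟩ := Finset.exists_ne_map_eq_of_card_lt_of_maps_to hcard
    (f := fun v => f fun i => (v i : ℤ)) fun _ _ => Finset.mem_coe.2 (Finset.mem_univ _)
  simp only [box, Fintype.mem_piFinset, Finset.mem_range] at hv hw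
  refine ⟨(fun i => (v i : ℤ)) - fun i => (w i : ℤ), fun h0 => hne ?_, fun i => ?_, ?_⟩
  · funext i
    exact_mod_cast congrFun (sub_eq_zero.1 h0) i
  · have := hv i
    have := hw i
    rw [Pi.sub_apply, abs_le]
    omega
  · rw [map_sub, sub_eq_zero]
    exact heq

lemma natCast_dvd_add_of_sq_eq_neg_mul {n : ℕ} {q r y z : ℤ} {t : ZMod n} (hq : IsCoprime q n)
    (ht : t ^ 2 = -(q * r)) (h : (q * y : ZMod n) = t * z) : (n : ℤ) ∣ q * y ^ 2 + r * z ^ 2 := by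
  refine hq.symm.dvd_of_dvd_mul_left ?_
  rw [← ZMod.intCast_zmod_eq_zero_iff_dvd]
  push_cast
  linear_combination (q * y + t * z) * h + (z : ZMod n) ^ 2 * ht

lemma sq_lt_of_squarefree {w : ℤ} {n : ℕ} (hn : Squarefree n) (h1 : n ≠ 1) (hw : w ^ 2 ≤ n) :
    w ^ 2 < n := by
  refine hw.lt_of_ne fun heq => h1 ?_
  have hsq : w.natAbs * w.natAbs = n := by
    zify
    rw [← sq, sq_abs, heq]
  have hunit := Nat.isUnit_iff.1 (hn w.natAbs ⟨1, by rw [hsq, mul_one]⟩)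
  rw [← hsq, hunit]

lemma sq_le_of_abs_le_sqrt {x : ℤ} {n : ℕ} (hx : |x| ≤ n.sqrt) : x ^ 2 ≤ n :=
  calc x ^ 2 = |x| ^ 2 := (sq_abs x).symm
    _ ≤ (n.sqrt : ℤ) ^ 2 := by gcongr
    _ ≤ n := by exact_mod_cast Nat.sqrt_le' n

lemma mul_lt_prod_sqrt_add_one (a b c : ℕ) :
    a * (b * c) < ((b * c).sqrt + 1) * ((c * a).sqrt + 1) * ((a * b).sqrt + 1) := by
  refine lt_of_pow_lt_pow_left₀ 2 (Nat.zero_le _) ?_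
  calc (a * (b * c)) ^ 2 = (b * c) * (c * a) * (a * b) := by ring
    _ < ((b * c).sqrt + 1) ^ 2 * ((c * a).sqrt + 1) ^ 2 * ((a * b).sqrt + 1) ^ 2 :=
      Nat.mul_lt_mul'' (Nat.mul_lt_mul'' (Nat.lt_succ_sqrt' _) (Nat.lt_succ_sqrt' _))
        (Nat.lt_succ_sqrt' _)
    _ = _ := by ring

/-- Modulo each coefficient the form `a x² + b y² - c z²` is a product of two linear forms; the
three congruences that make one factor vanish have a small common solution. -/
lemma exists_small_dvd_ternary {a b c : ℕ} [NeZero a] [NeZero b] [NeZero c]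
    (hab : a.Coprime b) (hbc : b.Coprime c) (hca : c.Coprime a)
    (ha : IsSquare (b * c : ZMod a)) (hb : IsSquare (c * a : ZMod b))
    (hc : IsSquare (-(a * b) : ZMod c)) :
    ∃ x y z : ℤ, ¬ (x = 0 ∧ y = 0 ∧ z = 0) ∧ x ^ 2 ≤ (b * c : ℕ) ∧ y ^ 2 ≤ (c * a : ℕ) ∧
      z ^ 2 ≤ (a * b : ℕ) ∧ (a * b * c : ℤ) ∣ a * x ^ 2 + b * y ^ 2 - c * z ^ 2 := by
  obtain ⟨ta, hta⟩ := ha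
  obtain ⟨tb, htb⟩ := hb
  obtain ⟨tc, htc⟩ := hc
  let f : (Fin 3 → ℤ) →+ ZMod a × ZMod b × ZMod c :=
    { toFun := fun v => (b * v 1 - ta * v 2, c * v 2 - tb * v 0, a * v 0 - tc * v 1)
      map_zero' := by simp
      map_add' := fun v w => by
        simp only [Pi.add_apply, Int.cast_add, Prod.mk_add_mk, Prod.mk.injEq]
        refine ⟨?_, ?_, ?_⟩ <;> ring }
  obtain ⟨v, hv0, hv, hfv⟩ := exists_ne_zero_abs_le_map_eq_zero f
    ![(b * c).sqrt, (c * a).sqrt, (a * b).sqrt] (by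
      simpa [Fin.prod_univ_three, Fintype.card_prod, ZMod.card] using
        mul_lt_prod_sqrt_add_one a b c)
  simp only [f, AddMonoidHom.coe_mk, ZeroHom.coe_mk, Prod.mk_eq_zero, sub_eq_zero] at hfv
  obtain ⟨hfa, hfb, hfc⟩ := hfv
  have da : (a : ℤ) ∣ b * v 1 ^ 2 + -c * v 2 ^ 2 :=
    natCast_dvd_add_of_sq_eq_neg_mul (t := ta) (Nat.isCoprime_iff_coprime.2 hab.symm)
      (by push_cast; linear_combination -hta) (mod_cast hfa)
  have db : (b : ℤ) ∣ c * v 2 ^ 2 + -a * v 0 ^ 2 :=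
    natCast_dvd_add_of_sq_eq_neg_mul (t := tb) (Nat.isCoprime_iff_coprime.2 hbc.symm)
      (by push_cast; linear_combination -htb) (mod_cast hfb)
  have dc : (c : ℤ) ∣ a * v 0 ^ 2 + b * v 1 ^ 2 :=
    natCast_dvd_add_of_sq_eq_neg_mul (t := tc) (Nat.isCoprime_iff_coprime.2 hca.symm)
      (by push_cast; linear_combination -htc) (mod_cast hfc)
  refine ⟨v 0, v 1, v 2, fun ⟨h0, h1, h2⟩ => hv0 ?_, sq_le_of_abs_le_sqrt (hv 0),
    sq_le_of_abs_le_sqrt (hv 1), sq_le_of_abs_le_sqrt (hv 2), ?_⟩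
  · funext i
    fin_cases i <;> assumption
  · have hcab : IsCoprime (a * b : ℤ) c := IsCoprime.mul_left
      (Nat.isCoprime_iff_coprime.2 hca.symm) (Nat.isCoprime_iff_coprime.2 hbc)
    refine hcab.mul_dvd (IsCoprime.mul_dvd (Nat.isCoprime_iff_coprime.2 hab) ?_ ?_) ?_
    · exact (dvd_add da (dvd_mul_right _ (v 0 ^ 2))).trans (dvd_of_eq (by ring))
    · exact (dvd_sub (dvd_mul_right _ (v 1 ^ 2)) db).trans (dvd_of_eq (by ring))
    · exact (dvd_sub dc (dvd_mul_right _ (v 2 ^ 2))).trans (dvd_of_eq (by ring))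

/-- The ternary form `a x² + b y² + c z²` is isotropic over `ℤ`, equivalently over `ℚ`. -/
def IsIsotropic (a b c : ℤ) : Prop :=
  ∃ x y z : ℤ, ¬ (x = 0 ∧ y = 0 ∧ z = 0) ∧ a * x ^ 2 + b * y ^ 2 + c * z ^ 2 = 0

lemma IsIsotropic.rotate {a b c : ℤ} : IsIsotropic a b c → IsIsotropic b c a
  | ⟨x, y, z, hne, h⟩ => ⟨y, z, x, by tauto, by linear_combination h⟩

lemma IsIsotropic.of_neg {a b c : ℤ} : IsIsotropic (-a) (-b) (-c) → IsIsotropic a b c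
  | ⟨x, y, z, hne, h⟩ => ⟨x, y, z, hne, by linear_combination -h⟩

/-- If the form takes the value `0` or `a b c` at a small point then it is isotropic; the other
multiples of `a b c` are excluded by size. -/
lemma isIsotropic_of_small {a b c : ℕ} (ha : 0 < a) (hb : 0 < b) (hc : 0 < c) {x y z : ℤ}
    (hne : ¬ (x = 0 ∧ y = 0 ∧ z = 0)) (hx : x ^ 2 ≤ b * c) (hy : y ^ 2 ≤ c * a)
    (hxy : x ^ 2 < b * c ∨ y ^ 2 < c * a) (hz : z ^ 2 < a * b)
    (hdvd : (a * b * c : ℤ) ∣ a * x ^ 2 + b * y ^ 2 - c * z ^ 2) : IsIsotropic a b (-c) := by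
  have ha' : (0 : ℤ) < a := mod_cast ha
  have hb' : (0 : ℤ) < b := mod_cast hb
  have hc' : (0 : ℤ) < c := mod_cast hc
  have habc : (0 : ℤ) < a * b * c := by positivity
  obtain ⟨k, hk⟩ := hdvd
  have lower : -(a * b * c : ℤ) < a * b * c * k := by
    have := mul_lt_mul_of_pos_left hz hc'
    have := mul_nonneg ha'.le (sq_nonneg x)
    have := mul_nonneg hb'.le (sq_nonneg y)
    linarith
  have upper : a * b * c * k < 2 * (a * b * c : ℤ) := by
    have := mul_le_mul_of_nonneg_left hx ha'.le
    have := mul_le_mul_of_nonneg_left hy hb'.le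
    have := mul_nonneg hc'.le (sq_nonneg z)
    rcases hxy with hlt | hlt
    · have := mul_lt_mul_of_pos_left hlt ha'
      linarith
    · have := mul_lt_mul_of_pos_left hlt hb'
      linarith
  have hk0 : -1 < k := lt_of_mul_lt_mul_left (by linarith) habc.le
  have hk2 : k < 2 := lt_of_mul_lt_mul_left (by linarith) habc.le
  interval_cases k
  · exact ⟨x, y, z, hne, by linear_combination hk⟩
  · refine ⟨x * z + b * y, y * z - a * x, z ^ 2 + a * b, fun h0 => ?_, ?_⟩
    · have := h0.2.2
      nlinarith [sq_nonneg z, mul_pos ha' hb']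
    · linear_combination (z ^ 2 + (a : ℤ) * b) * hk

lemma isIsotropic_of_isSquare {a b c : ℕ} (habc : Squarefree (a * b * c))
    (ha : IsSquare (b * c : ZMod a)) (hb : IsSquare (c * a : ZMod b))
    (hc : IsSquare (-(a * b) : ZMod c)) : IsIsotropic a b (-c) := by
  have hab' : Squarefree (a * b) := habc.squarefree_of_dvd ⟨c, rfl⟩
  have hbc' : Squarefree (b * c) := habc.squarefree_of_dvd ⟨a, by ring⟩
  have hca' : Squarefree (c * a) := habc.squarefree_of_dvd ⟨b, by ring⟩
  have : NeZero a := ⟨right_ne_zero_of_mul hca'.ne_zero⟩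
  have : NeZero b := ⟨right_ne_zero_of_mul hab'.ne_zero⟩
  have : NeZero c := ⟨right_ne_zero_of_mul hbc'.ne_zero⟩
  by_cases hab1 : a * b = 1
  · obtain ⟨rfl, rfl⟩ := mul_eq_one.1 hab1
    obtain ⟨x, y, hxy⟩ := Nat.eq_sq_add_sq_of_isSquare_mod_neg_one (by simpa using hc)
    exact ⟨x, y, 1, by simp, by rw [hxy]; push_cast; ring⟩
  obtain ⟨x, y, z, hne, hx, hy, hz, hdvd⟩ := exists_small_dvd_ternary
    (Nat.coprime_of_squarefree_mul hab') (Nat.coprime_of_squarefree_mul hbc')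
    (Nat.coprime_of_squarefree_mul hca') ha hb hc
  have hxy : x ^ 2 < (b * c : ℕ) ∨ y ^ 2 < (c * a : ℕ) := by
    by_cases hbc1 : b * c = 1
    · refine .inr (sq_lt_of_squarefree hca' (fun hca1 => hab1 ?_) hy)
      rw [(mul_eq_one.1 hca1).2, (mul_eq_one.1 hbc1).1, one_mul]
    · exact .inl (sq_lt_of_squarefree hbc' hbc1 hx)
  have hz' := sq_lt_of_squarefree hab' hab1 hz
  push_cast at hx hy hxy hz'
  exact isIsotropic_of_small (Nat.pos_of_neZero a) (Nat.pos_of_neZero b) (Nat.pos_of_neZero c)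
    hne hx hy hxy hz' hdvd

/-- The local solvability conditions of Legendre's theorem for `a x² + b y² + c z² = 0` at the odd
primes. There is none at `2`, since every residue modulo `2` is a square. -/
structure IsLegendreTriple (a b c : ℤ) : Prop where
  squarefree : Squarefree (a * b * c)
  isSquare₁ : ∀ l : ℕ, l.Prime → l ≠ 2 → (l : ℤ) ∣ a → IsSquare ((-(b * c) : ℤ) : ZMod l)
  isSquare₂ : ∀ l : ℕ, l.Prime → l ≠ 2 → (l : ℤ) ∣ b → IsSquare ((-(c * a) : ℤ) : ZMod l)
  isSquare₃ : ∀ l : ℕ, l.Prime → l ≠ 2 → (l : ℤ) ∣ c → IsSquare ((-(a * b) : ℤ) : ZMod l)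

namespace IsLegendreTriple

variable {a b c : ℤ}

lemma rotate (h : IsLegendreTriple a b c) : IsLegendreTriple b c a :=
  ⟨by convert h.squarefree using 1; ring, h.isSquare₂, h.isSquare₃, h.isSquare₁⟩

lemma neg (h : IsLegendreTriple a b c) : IsLegendreTriple (-a) (-b) (-c) where
  squarefree := by
    rw [← Int.squarefree_natAbs]
    simpa [Int.natAbs_mul] using Int.squarefree_natAbs.2 h.squarefree
  isSquare₁ := by simpa using h.isSquare₁
  isSquare₂ := by simpa using h.isSquare₂
  isSquare₃ := by simpa using h.isSquare₃

lemma isIsotropic_of_pos_pos_neg (h : IsLegendreTriple a b c) (ha : 0 < a) (hb : 0 < b)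
    (hc : c < 0) : IsIsotropic a b c := by
  lift a to ℕ using ha.le
  lift b to ℕ using hb.le
  obtain ⟨c, rfl⟩ : ∃ n : ℕ, c = -n := ⟨c.natAbs, by omega⟩
  have habc : Squarefree (a * b * c) := by
    simpa [Int.natAbs_mul] using Int.squarefree_natAbs.2 h.squarefree
  have isSquare_of_odd {l : ℕ} {n : ℤ} (hn : l ≠ 2 → IsSquare (n : ZMod l)) :
      IsSquare (n : ZMod l) := by
    by_cases hl : l = 2
    · subst hl
      generalize (n : ZMod 2) = r
      decide +revert
    · exact hn hl
  refine isIsotropic_of_isSquare habc ?_ ?_ ?_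
  · have : IsSquare ((b * c : ℤ) : ZMod a) :=
      isSquare_zmod_of_squarefree (habc.squarefree_of_dvd ⟨b * c, by ring⟩) fun l hl hd =>
        isSquare_of_odd fun h2 => by simpa using h.isSquare₁ l hl h2 (mod_cast hd)
    exact_mod_cast this
  · have : IsSquare ((c * a : ℤ) : ZMod b) :=
      isSquare_zmod_of_squarefree (habc.squarefree_of_dvd ⟨a * c, by ring⟩) fun l hl hd =>
        isSquare_of_odd fun h2 => by simpa using h.isSquare₂ l hl h2 (mod_cast hd)
    exact_mod_cast this
  · have : IsSquare ((-(a * b) : ℤ) : ZMod c) :=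
      isSquare_zmod_of_squarefree (habc.squarefree_of_dvd ⟨a * b, by ring⟩) fun l hl hd =>
        isSquare_of_odd fun h2 => h.isSquare₃ l hl h2 (by simpa using Int.natCast_dvd_natCast.2 hd)
    simpa using this

/-- **Legendre's theorem** on ternary quadratic forms. -/
theorem isIsotropic (h : IsLegendreTriple a b c) (hpos : ¬ (0 < a ∧ 0 < b ∧ 0 < c))
    (hneg : ¬ (a < 0 ∧ b < 0 ∧ c < 0)) : IsIsotropic a b c := by
  have h0 := h.squarefree.ne_zero
  have ha0 : a ≠ 0 := left_ne_zero_of_mul (left_ne_zero_of_mul h0)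
  have hb0 : b ≠ 0 := right_ne_zero_of_mul (left_ne_zero_of_mul h0)
  have hc0 : c ≠ 0 := right_ne_zero_of_mul h0
  rcases ha0.lt_or_gt with ha | ha <;> rcases hb0.lt_or_gt with hb | hb <;>
    rcases hc0.lt_or_gt with hc | hc
  · exact absurd ⟨ha, hb, hc⟩ hneg
  · exact .of_neg (h.neg.isIsotropic_of_pos_pos_neg (by omega) (by omega) (by omega))
  · exact .rotate <| .of_neg <|
      h.rotate.rotate.neg.isIsotropic_of_pos_pos_neg (by omega) (by omega) (by omega)
  · exact .rotate <| .rotate <| h.rotate.isIsotropic_of_pos_pos_neg hb hc ha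
  · exact .rotate <| .rotate <| .of_neg <|
      h.rotate.neg.isIsotropic_of_pos_pos_neg (by omega) (by omega) (by omega)
  · exact .rotate <| h.rotate.rotate.isIsotropic_of_pos_pos_neg hc ha hb
  · exact h.isIsotropic_of_pos_pos_neg ha hb hc
  · exact absurd ⟨ha, hb, hc⟩ hpos

end IsLegendreTriple

end LegendreTheorem

lemma exists_binary_eq_of_isotropic {K : Type*} [Field K] [NeZero (2 : K)] {a b u v : K}
    (ha : a ≠ 0) (hu : u ≠ 0) (h : a * u ^ 2 + b * v ^ 2 = 0) (d : K) :
    ∃ x y : K, a * x ^ 2 + b * y ^ 2 = d := by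
  have h2 : (2 : K) ≠ 0 := two_ne_zero
  refine ⟨(a * d + 1) / (2 * a), (a * d - 1) * v / (2 * a * u), ?_⟩
  field_simp
  linear_combination (a * d - 1) ^ 2 * h

lemma IsIsotropic.exists_binary_eq {a b d : ℤ} (ha : a ≠ 0) (hb : b ≠ 0)
    (h : IsIsotropic a b (-d)) : ∃ x y : ℚ, a * x ^ 2 + b * y ^ 2 = d := by
  obtain ⟨x, y, z, hne, h⟩ := h
  have h' : (a : ℚ) * x ^ 2 + b * y ^ 2 = d * z ^ 2 := by
    exact_mod_cast (by linear_combination h : a * x ^ 2 + b * y ^ 2 = d * z ^ 2)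
  by_cases hz : z = 0
  · subst hz
    have hx : x ≠ 0 := by
      rintro rfl
      have : b * y ^ 2 = 0 := by linear_combination h
      simp [hb] at this
      tauto
    refine exists_binary_eq_of_isotropic (u := (x : ℚ)) (v := y) (mod_cast ha) (mod_cast hx) ?_ _
    simpa using h'
  · have hz' : (z : ℚ) ≠ 0 := mod_cast hz
    refine ⟨x / z, y / z, ?_⟩
    field_simp
    linear_combination h'

lemma exists_ternary_eq_of_isIsotropic {A B C w d : ℤ} (hA : A ≠ 0) (hB : B ≠ 0) (hC : C ≠ 0)
    (hw : w ≠ 0) (h₁ : IsIsotropic A (-B) (-w)) (h₂ : IsIsotropic (A * B) (C * w) (-d)) :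
    ∃ x y z : ℚ, A * B * x ^ 2 + A * C * y ^ 2 - B * C * z ^ 2 = d := by
  obtain ⟨x, y, hxy⟩ := h₁.exists_binary_eq hA (neg_ne_zero.2 hB)
  obtain ⟨u, v, huv⟩ := h₂.exists_binary_eq (mul_ne_zero hA hB) (mul_ne_zero hC hw)
  refine ⟨u, v * x, v * y, ?_⟩
  push_cast at hxy huv
  linear_combination huv + C * v ^ 2 * hxy

section JacobiSymbol

lemma jacobiSym_congr {a b : ℤ} {n : ℕ} (h : (n : ℤ) ∣ a - b) :
    jacobiSym a n = jacobiSym b n :=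
  jacobiSym.mod_left' (Int.emod_eq_emod_iff_emod_sub_eq_zero.2 (Int.emod_eq_zero_of_dvd h))

lemma jacobiSym_congr_of_prime {a b : ℤ} {n : ℕ} (hn : n ≠ 0)
    (h : ∀ l : ℕ, l.Prime → l ∣ n → jacobiSym a l = jacobiSym b l) :
    jacobiSym a n = jacobiSym b n := by
  induction n using induction_on_primes with
  | zero => exact absurd rfl hn
  | one => simp
  | prime_mul p m hp ih =>
    have hm : m ≠ 0 := right_ne_zero_of_mul hn
    rw [jacobiSym.mul_right' _ hp.ne_zero hm, jacobiSym.mul_right' _ hp.ne_zero hm,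
      h p hp (dvd_mul_right _ _), ih hm fun l hl hd => h l hl (hd.mul_left _)]

lemma not_dvd_of_squarefree_mul {x y : ℤ} {l : ℕ} (h : Squarefree (x * y)) (hl : l.Prime)
    (hx : (l : ℤ) ∣ x) : ¬ (l : ℤ) ∣ y := fun hy =>
  (Nat.prime_iff_prime_int.1 hl).not_isUnit (h l (mul_dvd_mul hx hy))

lemma jacobiSym_sq_of_not_dvd {a : ℤ} {l : ℕ} (hl : l.Prime) (ha : ¬ (l : ℤ) ∣ a) :
    jacobiSym a l ^ 2 = 1 := by
  refine jacobiSym.sq_one ?_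
  rw [Int.gcd_comm, Int.gcd_eq_natAbs, Int.natAbs_natCast]
  exact (Nat.Prime.coprime_iff_not_dvd hl).2 fun hd => ha (Int.natCast_dvd.2 hd)

lemma not_dvd_of_jacobiSym_sq {a : ℤ} {l : ℕ} (hl : l.Prime) (ha : jacobiSym a l ^ 2 = 1) :
    ¬ (l : ℤ) ∣ a := by
  intro hd
  have : Fact l.Prime := ⟨hl⟩
  rw [← jacobiSym.legendreSym.to_jacobiSym,
    (legendreSym.eq_zero_iff _ _).2 ((ZMod.intCast_zmod_eq_zero_iff_dvd _ _).2 hd)] at ha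
  norm_num at ha

lemma jacobiSym_sq_of_isCoprime {a b : ℤ} (h : IsCoprime a b) :
    jacobiSym a b.natAbs ^ 2 = 1 :=
  jacobiSym.sq_one (Int.isCoprime_iff_gcd_eq_one.1 h :)

lemma isSquare_of_jacobiSym_eq_one {a : ℤ} {l : ℕ} (hl : l.Prime) (ha : jacobiSym a l = 1) :
    IsSquare (a : ZMod l) :=
  have : Fact l.Prime := ⟨hl⟩
  ZMod.isSquare_of_jacobiSym_eq_one ha

lemma isSquare_of_dvd_sub {a b : ℤ} {l : ℕ} (h : (l : ℤ) ∣ a - b ^ 2) :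
    IsSquare (a : ZMod l) := by
  refine ⟨b, ?_⟩
  rw [← (ZMod.intCast_eq_intCast_iff_dvd_sub _ _ _).2 h]
  push_cast
  ring

lemma map_natAbs_cast_of_map_neg_one {R M : Type*} [CommRing R] [CommMonoidWithZero M]
    {χ : MulChar R M} (hχ : χ (-1) = 1) (c : ℤ) : χ (c.natAbs : R) = χ (c : R) := by
  rcases Int.natAbs_eq c with h | h <;> conv_rhs => rw [h]
  · simp
  · rw [Int.cast_neg, ← neg_one_mul, map_mul, hχ, one_mul, Int.cast_natCast]

/-- The factor at `2` in the law of quadratic reciprocity: the Hilbert symbol at `2` of two odd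
integers. -/
def reciprocitySign (x y : ℤ) : ℤ := if x % 4 = 3 ∧ y % 4 = 3 then -1 else 1

/-- The factor for `x, y < 0` is the Hilbert symbol at the real place. -/
lemma jacobiSym_natAbs_swap {x y : ℤ} (hx : Odd x) (hy : Odd y) :
    jacobiSym x y.natAbs = (if x < 0 ∧ y < 0 then -1 else 1) * reciprocitySign x y *
      jacobiSym y x.natAbs := by
  have hx2 := Nat.odd_iff.1 (Int.natAbs_odd.2 hx)
  have hy2 := Nat.odd_iff.1 (Int.natAbs_odd.2 hy)
  have hswap := jacobiSym.quadratic_reciprocity_if hx2 hy2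
  have hneg {n m : ℕ} (hm : m % 2 = 1) :
      jacobiSym (-n) m = (if m % 4 = 1 then 1 else -1) * jacobiSym n m := by
    rw [jacobiSym.neg _ (Nat.odd_iff.2 hm), ZMod.χ₄_nat_eq_if_mod_four, if_neg (by omega)]
  rcases Int.natAbs_eq x with hx' | hx' <;> rcases Int.natAbs_eq y with hy' | hy' <;>
    generalize x.natAbs = m at * <;> generalize y.natAbs = n at * <;> subst hx' hy' <;>
    simp only [reciprocitySign, hneg hx2, hneg hy2, ← hswap] <;> split_ifs <;> omega

lemma jacobiSym_eq_of_emod_four_eq_one {d : ℤ} (hd : d % 4 = 1) {n : ℕ} (hn : Odd n) :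
    jacobiSym n d.natAbs = jacobiSym d n := by
  have h := jacobiSym_natAbs_swap ((Int.odd_coe_nat n).2 hn) (Int.odd_iff.2 (by omega : d % 2 = 1))
  rw [if_neg (by omega), reciprocitySign, if_neg (by omega)] at h
  simpa using h

end JacobiSymbol

/-- Coefficients of the ternary forms `AB x² + AC y² - BC z²` for which the local conditions of the
Hasse principle take a uniform shape. Such a form is the norm form of the quaternion algebra
`(AB, AC)` on trace-zero elements, up to sign. -/
structure Admissible (A B C : ℤ) : Prop where
  pos : 0 < A
  squarefree : Squarefree (A * B * C)
  odd_left : Odd A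
  odd_right : Odd C
  middle : A * B = -1 ∨ A * B % 16 = 2 ∨ A * B % 16 = 14

/-- The Hilbert symbol of the quaternion algebra `(AB, AC)` at an odd prime. -/
def localSymbol (A B C : ℤ) (l : ℕ) : ℤ :=
  if (l : ℤ) ∣ A then jacobiSym (-(B * C)) l
  else if (l : ℤ) ∣ B then jacobiSym (A * C) l
  else if (l : ℤ) ∣ C then jacobiSym (A * B) l
  else 1

/-- The quaternion algebra `(AB, AC)` is ramified at `2`, for admissible `A`, `B`, `C`. -/
def RamifiedTwo (A B C : ℤ) : Prop :=
  (A * B = -1 ∧ A * C % 4 = 3) ∨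
  (A * B % 16 = 2 ∧ (A * C % 8 = 3 ∨ A * C % 8 = 5)) ∨
  (A * B % 16 = 14 ∧ (A * C % 8 = 5 ∨ A * C % 8 = 7))

instance (A B C : ℤ) : Decidable (RamifiedTwo A B C) := by
  unfold RamifiedTwo; infer_instance

/-- The quaternion algebra `(AB, AC)` is ramified at the real place. -/
def RamifiedReal (A B C : ℤ) : Prop := A * B < 0 ∧ A * C < 0

lemma localSymbol_left {A B C : ℤ} {l : ℕ} (hA : (l : ℤ) ∣ A) :
    localSymbol A B C l = jacobiSym (-(B * C)) l := if_pos hA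

namespace Admissible

variable {A B C : ℤ} {l : ℕ} (h : Admissible A B C)

include h

lemma middle_ne_zero : B ≠ 0 := right_ne_zero_of_mul (left_ne_zero_of_mul h.squarefree.ne_zero)

lemma right_ne_zero : C ≠ 0 := right_ne_zero_of_mul h.squarefree.ne_zero

lemma not_dvd_left (hl : l.Prime) (hA : (l : ℤ) ∣ A) : ¬ (l : ℤ) ∣ B * C :=
  not_dvd_of_squarefree_mul (by rw [← mul_assoc]; exact h.squarefree) hl hA

lemma not_dvd_middle (hl : l.Prime) (hB : (l : ℤ) ∣ B) : ¬ (l : ℤ) ∣ A * C :=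
  not_dvd_of_squarefree_mul (by convert h.squarefree using 1; ring) hl hB

lemma not_dvd_right (hl : l.Prime) (hC : (l : ℤ) ∣ C) : ¬ (l : ℤ) ∣ A * B :=
  not_dvd_of_squarefree_mul (by convert h.squarefree using 1; ring) hl hC

lemma localSymbol_middle (hl : l.Prime) (hB : (l : ℤ) ∣ B) :
    localSymbol A B C l = jacobiSym (A * C) l := by
  have hA : ¬ (l : ℤ) ∣ A := fun hA => h.not_dvd_middle hl hB (hA.mul_right _)
  rw [localSymbol, if_neg hA, if_pos hB]

lemma localSymbol_right (hl : l.Prime) (hC : (l : ℤ) ∣ C) :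
    localSymbol A B C l = jacobiSym (A * B) l := by
  have hA : ¬ (l : ℤ) ∣ A := fun hA => h.not_dvd_right hl hC (hA.mul_right _)
  have hB : ¬ (l : ℤ) ∣ B := fun hB => h.not_dvd_right hl hC (hB.mul_left _)
  rw [localSymbol, if_neg hA, if_neg hB, if_pos hC]

lemma localSymbol_sq (hl : l.Prime) (hd : (l : ℤ) ∣ A * B * C) :
    localSymbol A B C l ^ 2 = 1 := by
  have hlp := Nat.prime_iff_prime_int.1 hl
  rcases hlp.dvd_or_dvd hd with hAB | hC
  · rcases hlp.dvd_or_dvd hAB with hA | hB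
    · rw [localSymbol_left hA]
      exact jacobiSym_sq_of_not_dvd hl (by rw [dvd_neg]; exact h.not_dvd_left hl hA)
    · rw [h.localSymbol_middle hl hB]
      exact jacobiSym_sq_of_not_dvd hl (h.not_dvd_middle hl hB)
  · rw [h.localSymbol_right hl hC]
    exact jacobiSym_sq_of_not_dvd hl (h.not_dvd_right hl hC)

lemma localSymbol_eq_one_of_ne (hl : l.Prime) (hd : (l : ℤ) ∣ A * B * C)
    (hne : localSymbol A B C l ≠ -1) : localSymbol A B C l = 1 :=
  (mul_self_eq_one_iff.1 (by rw [← sq, h.localSymbol_sq hl hd])).resolve_right hne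

lemma exists_oddPart :
    ∃ β : ℤ, Odd β ∧ (B = 2 * β ∨ A = 1 ∧ B = -1 ∧ β = -1) := by
  have hpos := h.pos
  rcases h.middle with hm | hm
  · have hA : A = 1 := by
      rcases Int.mul_eq_neg_one_iff_eq_one_or_neg_one.1 hm with h1 | h1 <;> omega
    exact ⟨-1, by decide, .inr ⟨hA, by simpa [hA] using hm, rfl⟩⟩
  · have hB : ¬ Odd B := fun hB => by
      have := Int.odd_iff.1 (h.odd_left.mul hB)
      omega
    obtain ⟨β, hβ⟩ := (Int.not_odd_iff_even.1 hB).two_dvd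
    refine ⟨β, Int.not_even_iff_odd.1 fun heven => ?_, .inl hβ⟩
    obtain ⟨γ, rfl⟩ := heven.two_dvd
    have : A * B = 4 * (A * γ) := by rw [hβ]; ring
    omega

end Admissible

lemma jacobiSym_neg_one_natAbs_eq_ramifiedTwo {C : ℤ} (hC : Odd C) :
    jacobiSym (-1) C.natAbs =
      (if RamifiedTwo 1 (-1) C then -1 else 1) * (if C < 0 then -1 else 1) := by
  have hram : RamifiedTwo 1 (-1) C ↔ C % 4 = 3 := by simp [RamifiedTwo]
  have := Int.odd_iff.1 hC
  simp only [jacobiSym.at_neg_one (Int.natAbs_odd.2 hC), ZMod.χ₄_nat_eq_if_mod_four, hram]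
  split_ifs <;> omega

section ProductFormula

variable {A β C : ℤ}

lemma emod_eight_eq_mul_of_mul_emod_eight {r : ℤ} (hA : Odd A) (hm : A * β % 8 = r) :
    β % 8 = A * r % 8 := by
  have hsq : A ^ 2 ≡ 1 [ZMOD 8] := (Int.modEq_iff_dvd.2 (Int.eight_dvd_sq_sub_one_of_odd hA)).symm
  calc β % 8 = 1 * β % 8 := by rw [one_mul]
    _ = A ^ 2 * β % 8 := hsq.symm.mul_right β
    _ = A * (A * β) % 8 := by rw [sq, mul_assoc]
    _ = A * r % 8 := (hm ▸ Int.mod_modEq (A * β) 8).symm.mul_left A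

lemma reciprocitySign_eq_of_mul_emod_eight_eq_one (hA : Odd A) (hC : Odd C) (hm : A * β % 8 = 1) :
    reciprocitySign A β * reciprocitySign A C * reciprocitySign β C *
      (ZMod.χ₈' A * ZMod.χ₈ C) = ZMod.χ₈ (A * C : ℤ) := by
  have hβ := emod_eight_eq_mul_of_mul_emod_eight hA hm
  have hA := Int.odd_iff.1 hA
  have hC := Int.odd_iff.1 hC
  rw [ZMod.χ₈'_int_eq_χ₄_mul_χ₈, Int.cast_mul, map_mul, ZMod.χ₄_int_eq_if_mod_four]
  simp only [reciprocitySign]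
  split_ifs <;> first | omega | ring

lemma reciprocitySign_eq_of_mul_emod_eight_eq_seven (hA : Odd A) (hC : Odd C) (hm : A * β % 8 = 7) :
    reciprocitySign A β * reciprocitySign A C * reciprocitySign β C *
      (ZMod.χ₈' A * ZMod.χ₈ C) = ZMod.χ₈' (A * C : ℤ) := by
  have hβ := emod_eight_eq_mul_of_mul_emod_eight hA hm
  have hA := Int.odd_iff.1 hA
  have hC := Int.odd_iff.1 hC
  have hχ : ZMod.χ₈' C = ZMod.χ₄ C * ZMod.χ₈ C := ZMod.χ₈'_int_eq_χ₄_mul_χ₈ C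
  rw [Int.cast_mul, map_mul, hχ, ZMod.χ₄_int_eq_if_mod_four]
  simp only [reciprocitySign]
  split_ifs <;> first | omega | ring

lemma jacobiSym_mul_eq_reciprocitySign (hpos : 0 < A) (hA : Odd A) (hβ : Odd β) (hC : Odd C)
    (hAβ : IsCoprime A β) (hAC : IsCoprime A C) (hβC : IsCoprime β C) :
    jacobiSym (-(2 * β * C)) A.natAbs * jacobiSym (A * C) β.natAbs *
        jacobiSym (A * (2 * β)) C.natAbs =
      reciprocitySign A β * reciprocitySign A C * reciprocitySign β C *
        (ZMod.χ₈' A * ZMod.χ₈ C) * (if β < 0 ∧ C < 0 then -1 else 1) := by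
  have hleft : jacobiSym (-(2 * β * C)) A.natAbs =
      ZMod.χ₈' A * jacobiSym β A.natAbs * jacobiSym C A.natAbs := by
    rw [show -(2 * β * C) = -2 * β * C by ring, jacobiSym.mul_left, jacobiSym.mul_left,
      jacobiSym.at_neg_two (Int.natAbs_odd.2 hA), ← Int.cast_natCast, Int.natAbs_of_nonneg hpos.le]
  have hright : jacobiSym (A * (2 * β)) C.natAbs =
      jacobiSym A C.natAbs * ZMod.χ₈ C * jacobiSym β C.natAbs := by
    rw [← mul_assoc, jacobiSym.mul_left, jacobiSym.mul_left,
      jacobiSym.at_two (Int.natAbs_odd.2 hC), map_natAbs_cast_of_map_neg_one (by decide)]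
  rw [hleft, hright, jacobiSym.mul_left, jacobiSym_natAbs_swap hA hβ, jacobiSym_natAbs_swap hA hC,
    jacobiSym_natAbs_swap hβ hC, if_neg (by omega), if_neg (by omega)]
  have hβA := jacobiSym_sq_of_isCoprime hAβ.symm
  have hCA := jacobiSym_sq_of_isCoprime hAC.symm
  have hCβ := jacobiSym_sq_of_isCoprime hβC.symm
  generalize jacobiSym β A.natAbs = x, jacobiSym C A.natAbs = y, jacobiSym C β.natAbs = z at *
  linear_combination
    (if β < 0 ∧ C < 0 then -1 else 1) * reciprocitySign A β * reciprocitySign A C *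
      reciprocitySign β C * (ZMod.χ₈' A * ZMod.χ₈ C) *
        (y ^ 2 * z ^ 2 * hβA + z ^ 2 * hCA + hCβ)

/-- Hilbert's product formula for the quaternion algebra `(AB, AC)`. -/
theorem Admissible.product_formula {B : ℤ} (h : Admissible A B C) (hβ : Odd β)
    (hB : B = 2 * β ∨ A = 1 ∧ B = -1 ∧ β = -1) :
    jacobiSym (-(B * C)) A.natAbs * jacobiSym (A * C) β.natAbs * jacobiSym (A * B) C.natAbs =
      (if RamifiedTwo A B C then -1 else 1) * (if B < 0 ∧ C < 0 then -1 else 1) := by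
  rcases hB with rfl | ⟨rfl, rfl, rfl⟩
  · have hpair : IsRelPrime A (2 * β) ∧ IsRelPrime (A * (2 * β)) C :=
      ⟨(squarefree_mul_iff.1 (squarefree_mul_iff.1 h.squarefree).2.1).1,
        (squarefree_mul_iff.1 h.squarefree).1⟩
    have hAβ : IsCoprime A β := hpair.1.isCoprime.of_mul_right_right
    have hABC : IsCoprime (A * (2 * β)) C := hpair.2.isCoprime
    have hm : A * (2 * β) = 2 * (A * β) := by ring
    have hAC := Int.odd_iff.1 (h.odd_left.mul h.odd_right)
    have hreal : (2 * β < 0 ∧ C < 0) ↔ β < 0 ∧ C < 0 := by omega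
    rw [jacobiSym_mul_eq_reciprocitySign h.pos h.odd_left hβ h.odd_right hAβ
      hABC.of_mul_left_left hABC.of_mul_left_right.of_mul_left_right]
    have hmid := h.middle
    rw [hm] at hmid
    simp only [hreal]
    congr 1
    rcases (by omega : A * β % 8 = 1 ∨ A * β % 8 = 7) with h8 | h8
    · rw [reciprocitySign_eq_of_mul_emod_eight_eq_one h.odd_left h.odd_right h8,
        ZMod.χ₈_int_eq_if_mod_eight]
      simp only [RamifiedTwo, hm]
      split_ifs <;> omega
    · rw [reciprocitySign_eq_of_mul_emod_eight_eq_seven h.odd_left h.odd_right h8,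
        ZMod.χ₈'_int_eq_if_mod_eight]
      simp only [RamifiedTwo, hm]
      split_ifs <;> omega
  · simpa using jacobiSym_neg_one_natAbs_eq_ramifiedTwo h.odd_right

end ProductFormula

section Dirichlet

theorem exists_prime_gt_forall_dvd_sub {ι : Type*} [Finite ι] {n a : ι → ℤ} (hn : ∀ i, n i ≠ 0)
    (hcop : Pairwise fun i j => IsCoprime (n i) (n j)) (ha : ∀ i, IsCoprime (a i) (n i)) (N : ℕ) :
    ∃ q : ℕ, N < q ∧ q.Prime ∧ ∀ i, n i ∣ q - a i := by
  cases nonempty_fintype ι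
  let m (i : ι) : ℕ := (n i).natAbs
  have hm : Pairwise (Function.onFun Nat.Coprime m) := fun i j hij =>
    Int.isCoprime_iff_gcd_eq_one.1 (hcop hij)
  have : NeZero (∏ i, m i) := ⟨Finset.prod_ne_zero_iff.2 fun i _ => Int.natAbs_ne_zero.2 (hn i)⟩
  let e := ZMod.prodEquivPi m hm
  have hunit : IsUnit (fun i => ((a i : ℤ) : ZMod (m i))) := Pi.isUnit_iff.2 fun i => by
    rw [ZMod.coe_int_isUnit_iff_isCoprime, Int.isCoprime_iff_gcd_eq_one]
    exact (Int.isCoprime_iff_gcd_eq_one.1 (ha i).symm :)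
  obtain ⟨q, hq, hqp, hqa⟩ := Nat.forall_exists_prime_gt_and_eq_mod (hunit.map e.symm) N
  refine ⟨q, hq, hqp, fun i => Int.natAbs_dvd.1 ?_⟩
  rw [← ZMod.intCast_eq_intCast_iff_dvd_sub]
  have := congrFun (congrArg e hqa) i
  rw [map_natCast, RingEquiv.apply_symm_apply] at this
  simpa using this.symm

end Dirichlet

/-- The conditions at all places for the squarefree integer `d` to be represented by the form
`AB x² + AC y² - BC z²`: the field `ℚ(√d)` splits the quaternion algebra `(AB, AC)`, and all local
data at the bad primes are those of a fixed residue class. -/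
structure IsLocallyRepresented (A B C d : ℤ) : Prop where
  squarefree : Squarefree d
  emod_eight : d % 8 = if RamifiedTwo A B C then 5 else 1
  neg : RamifiedReal A B C → d < 0
  jacobiSym_eq : ∀ l : ℕ, l.Prime → l ≠ 2 → (l : ℤ) ∣ A * B * C →
    jacobiSym d l = localSymbol A B C l

namespace IsLocallyRepresented

variable {A B C d : ℤ} (hd : IsLocallyRepresented A B C d)

include hd

lemma emod_four : d % 4 = 1 := by
  have := hd.emod_eight
  split_ifs at this <;> omega

lemma odd : Odd d := Int.odd_iff.2 (by have := hd.emod_four; omega)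

lemma jacobiSym_two : jacobiSym 2 d.natAbs = if RamifiedTwo A B C then -1 else 1 := by
  have h8 := hd.emod_eight
  rw [jacobiSym.at_two (Int.natAbs_odd.2 hd.odd), map_natAbs_cast_of_map_neg_one (by decide),
    ZMod.χ₈_int_eq_if_mod_eight]
  split_ifs at h8 ⊢ <;> omega

lemma isCoprime (h : Admissible A B C) : IsCoprime (A * B * C) d := by
  refine isCoprime_of_prime_dvd (fun h0 => h.squarefree.ne_zero h0.1) fun p hp hpABC hpd => ?_
  have hl := Int.prime_iff_natAbs_prime.1 hp
  have hlABC := Int.natAbs_dvd.2 hpABC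
  have hld := Int.natAbs_dvd.2 hpd
  have h2 : p.natAbs ≠ 2 := fun h2 => by
    have := Int.odd_iff.1 hd.odd
    rw [h2] at hld
    omega
  refine not_dvd_of_jacobiSym_sq hl ?_ hld
  rw [hd.jacobiSym_eq _ hl h2 hlABC]
  exact h.localSymbol_sq hl hlABC

end IsLocallyRepresented

/-- An auxiliary factor `e`, used to represent `d` by the form `AB x² + AC y² - BC z²` through a
value `e q` of `A x² - B y²`: its sign makes the two conics involved solvable over `ℝ`. The integer
`γ` is the odd part of `e B`. -/
structure IsAuxiliaryFactor (A B C e γ : ℤ) : Prop where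
  odd : Odd γ
  mul_eq : e * B = 2 * γ
  isUnit_or : IsUnit e ∨ A = 1 ∧ B = -1 ∧ e = 2
  pos_of_neg : B < 0 → 0 < e
  neg_of_pos : 0 < B → C * e < 0

theorem Admissible.exists_isAuxiliaryFactor {A B C : ℤ} (h : Admissible A B C) :
    ∃ e γ : ℤ, IsAuxiliaryFactor A B C e γ := by
  obtain ⟨β, hβ, rfl | ⟨hA, hB, rfl⟩⟩ := h.exists_oddPart
  · rcases lt_or_gt_of_ne h.middle_ne_zero with hB | hB
    · exact ⟨1, β, hβ, one_mul _, .inl isUnit_one, fun _ => one_pos, fun _ => by omega⟩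
    · rcases lt_or_gt_of_ne h.right_ne_zero with hC | hC
      · exact ⟨1, β, hβ, one_mul _, .inl isUnit_one, fun _ => one_pos, fun _ => by omega⟩
      · exact ⟨-1, -β, hβ.neg, by ring, .inl isUnit_one.neg, fun _ => by omega, fun _ => by omega⟩
  · exact ⟨2, -1, hβ, by omega, .inr ⟨hA, hB, rfl⟩, fun _ => two_pos, fun _ => by omega⟩

namespace IsAuxiliaryFactor

variable {A B C e γ : ℤ} (he : IsAuxiliaryFactor A B C e γ)

include he

lemma dvd_two : e ∣ 2 := by
  rcases he.isUnit_or with h | ⟨-, -, rfl⟩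
  · exact h.dvd
  · rfl

lemma isCoprime_of_odd {n : ℤ} (hn : Odd n) : IsCoprime e n :=
  (Int.isCoprime_two_left.2 hn).of_isCoprime_of_dvd_left he.dvd_two

lemma ne_zero : γ ≠ 0 := by
  rintro rfl
  exact absurd he.odd (by decide)

lemma dvd_middle : γ ∣ B :=
  (he.isCoprime_of_odd he.odd).symm.dvd_of_dvd_mul_left (he.mul_eq ▸ dvd_mul_left γ 2)

lemma isCoprime {n : ℤ} (hn : Odd n) (h : IsCoprime n B) : IsCoprime n γ :=
  IsCoprime.of_mul_right_right (he.mul_eq ▸ (he.isCoprime_of_odd hn).symm.mul_right h :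
    IsCoprime n (2 * γ))

lemma dvd_of_dvd {l : ℕ} (hl : l.Prime) (h2 : l ≠ 2) (hB : (l : ℤ) ∣ B) : (l : ℤ) ∣ γ := by
  have h : (l : ℤ) ∣ 2 * γ := he.mul_eq ▸ hB.mul_left e
  refine ((Nat.prime_iff_prime_int.1 hl).dvd_or_dvd h).resolve_left fun h => h2 ?_
  exact (Nat.prime_dvd_prime_iff_eq hl Nat.prime_two).1 (by exact_mod_cast h)

lemma neg_mul_lt_zero_iff (hA : 0 < A) (hB : B ≠ 0) :
    -(A * γ * C) < 0 ↔ B < 0 ∧ C < 0 := by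
  rw [neg_lt_zero, mul_assoc, mul_pos_iff_of_pos_left hA]
  rcases lt_or_gt_of_ne hB with hB' | hB'
  · have : γ < 0 := by nlinarith [he.pos_of_neg hB', he.mul_eq]
    simp [hB', mul_pos_iff, this, this.le]
  · have hCeB := mul_neg_of_neg_of_pos (he.neg_of_pos hB') hB'
    have : C * γ * 2 = C * e * B := by linear_combination -C * he.mul_eq
    exact ⟨fun hγC => absurd hγC (by nlinarith), fun h => absurd h.1 hB'.not_gt⟩

lemma product_formula (h : Admissible A B C) :
    jacobiSym (-(B * C)) A.natAbs * jacobiSym (A * C) γ.natAbs * jacobiSym (A * B) C.natAbs =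
      (if RamifiedTwo A B C then -1 else 1) * (if B < 0 ∧ C < 0 then -1 else 1) := by
  rcases he.isUnit_or with hu | ⟨hA, hB, rfl⟩
  · have hB : B = 2 * (e * γ) := by
      linear_combination e * he.mul_eq - B * (Int.isUnit_mul_self hu)
    have he_odd : Odd e := Int.natAbs_odd.1 (Int.isUnit_iff_natAbs_eq.1 hu ▸ odd_one)
    rw [← h.product_formula (he_odd.mul he.odd) (.inl hB), Int.natAbs_mul,
      Int.isUnit_iff_natAbs_eq.1 hu, one_mul]
  · have hγ : γ = -1 := by have := he.mul_eq; omega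
    exact h.product_formula he.odd (.inr ⟨hA, hB, hγ⟩)

lemma isCoprime_mul (h : Admissible A B C) : IsCoprime e (A * B * C) := by
  rcases he.isUnit_or with hu | ⟨rfl, rfl, -⟩
  · exact isCoprime_one_left.of_isCoprime_of_dvd_left hu.dvd
  · exact he.isCoprime_of_odd (by simpa using h.odd_right)

lemma isCoprime_sub (h : Admissible A B C) : IsCoprime (e * (A - B)) (A * γ) := by
  have hAB : IsCoprime A B :=
    (squarefree_mul_iff.1 (squarefree_mul_iff.1 h.squarefree).2.1).1.isCoprime
  obtain ⟨k, hk⟩ := he.dvd_middle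
  refine .mul_left (he.isCoprime_of_odd (h.odd_left.mul he.odd)) (.mul_right ?_ ?_)
  · simpa [sub_eq_neg_add] using hAB.symm.neg_left.add_mul_left_left 1
  · rw [hk, sub_eq_add_neg, ← mul_neg]
    exact (he.isCoprime h.odd_left hAB).add_mul_left_left (-k)

lemma jacobiSym_mul_eq_one (h : Admissible A B C) {q : ℕ} (hq : q % 4 = 1)
    (hAγ : A * γ ∣ q - e * (A - B))
    (h2 : jacobiSym 2 q = jacobiSym (e * (A - B)) (A * γ).natAbs) : jacobiSym (A * B) q = 1 := by
  have hneg : jacobiSym (-1) q = 1 := by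
    rw [jacobiSym.at_neg_one (Nat.odd_iff.2 (by omega)), ZMod.χ₄_nat_one_mod_four hq]
  rcases he.isUnit_or with hu | ⟨rfl, rfl, -⟩
  · have hswap := jacobiSym_natAbs_swap (h.odd_left.mul he.odd)
      ((Int.odd_coe_nat q).2 (Nat.odd_iff.2 (by omega)))
    rw [if_neg (by omega), reciprocitySign, if_neg (by omega), Int.natAbs_natCast, one_mul, one_mul,
      jacobiSym_congr (Int.natAbs_dvd.2 hAγ), ← h2] at hswap
    have he1 : jacobiSym e q = 1 := by
      rcases Int.isUnit_iff.1 hu with rfl | rfl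
      exacts [jacobiSym.one_left q, hneg]
    have hAB : A * B = 2 * e * (A * γ) := by
      linear_combination e * A * he.mul_eq - A * B * Int.isUnit_mul_self hu
    rw [hAB, jacobiSym.mul_left, jacobiSym.mul_left, he1, mul_one, hswap, ← sq, h2]
    exact jacobiSym_sq_of_isCoprime (he.isCoprime_sub h)
  · simpa using hneg

lemma jacobiSym_natAbs_mul {d : ℤ} (h : Admissible A B C) (hd : IsLocallyRepresented A B C d) :
    jacobiSym d (A * γ * C).natAbs =
      (if RamifiedTwo A B C then -1 else 1) * (if B < 0 ∧ C < 0 then -1 else 1) := by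
  have hcongr {n a : ℤ} (hn : Odd n) (hlocal : ∀ l : ℕ, l.Prime → (l : ℤ) ∣ n →
      (l : ℤ) ∣ A * B * C ∧ localSymbol A B C l = jacobiSym a l) :
      jacobiSym d n.natAbs = jacobiSym a n.natAbs := by
    have hn := Int.natAbs_odd.2 hn
    refine jacobiSym_congr_of_prime hn.pos.ne' fun l hl hln => ?_
    obtain ⟨hlABC, hla⟩ := hlocal l hl (Int.natCast_dvd.2 hln)
    have hl2 : l ≠ 2 := by rintro rfl; exact Nat.not_even_iff_odd.2 hn (even_iff_two_dvd.2 hln)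
    rw [hd.jacobiSym_eq l hl hl2 hlABC, hla]
  have : NeZero A.natAbs := ⟨Int.natAbs_ne_zero.2 h.pos.ne'⟩
  have : NeZero γ.natAbs := ⟨Int.natAbs_ne_zero.2 he.ne_zero⟩
  have : NeZero C.natAbs := ⟨Int.natAbs_ne_zero.2 h.right_ne_zero⟩
  rw [Int.natAbs_mul, Int.natAbs_mul, jacobiSym.mul_right, jacobiSym.mul_right,
    ← he.product_formula h]
  refine congrArg₂ _ (congrArg₂ _ ?_ ?_) ?_
  · exact hcongr h.odd_left fun l _ hlA => ⟨(hlA.mul_right B).mul_right C, localSymbol_left hlA⟩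
  · refine hcongr he.odd fun l hl hlγ => ?_
    have hlB := hlγ.trans he.dvd_middle
    exact ⟨(hlB.mul_left A).mul_right C, h.localSymbol_middle hl hlB⟩
  · exact hcongr h.odd_right fun l hl hlC => ⟨hlC.mul_left _, h.localSymbol_right hl hlC⟩

lemma jacobiSym_eq_one {d : ℤ} (h : Admissible A B C) (hd : IsLocallyRepresented A B C d) {q : ℕ}
    (hq : Odd q) (hdvd : d ∣ q + e * (A * B * C)) : jacobiSym d q = 1 := by
  have hodd : Odd (-(A * γ * C)) := ((h.odd_left.mul he.odd).mul h.odd_right).neg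
  have hsign : (-(A * γ * C) < 0 ∧ d < 0) ↔ B < 0 ∧ C < 0 := by
    rw [he.neg_mul_lt_zero_iff h.pos h.middle_ne_zero]
    exact and_iff_left_of_imp fun hBC => hd.neg
      ⟨mul_neg_of_pos_of_neg h.pos hBC.1, mul_neg_of_pos_of_neg h.pos hBC.2⟩
  have hcongr : (d.natAbs : ℤ) ∣ q - 2 * -(A * γ * C) := by
    convert Int.natAbs_dvd.2 hdvd using 1
    linear_combination -A * C * he.mul_eq
  rw [← jacobiSym_eq_of_emod_four_eq_one hd.emod_four hq, jacobiSym_congr hcongr,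
    jacobiSym.mul_left, hd.jacobiSym_two, jacobiSym_natAbs_swap hodd hd.odd, reciprocitySign,
    if_neg (by have := hd.emod_four; omega : ¬ (_ ∧ d % 4 = 3)), Int.natAbs_neg,
    he.jacobiSym_natAbs_mul h hd]
  simp only [hsign]
  split_ifs <;> rfl

end IsAuxiliaryFactor

/-- A prime `q` for which the conics `A x² - B y² = e q z²` and `AB x² + C e q y² = d z²` both have
rational points. -/
structure IsAuxiliaryPrime (A B C d e γ : ℤ) (q : ℕ) : Prop where
  prime : q.Prime
  squarefree : Squarefree (e * (A * B * C) * d * q)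
  left_dvd : A ∣ q + e * B
  middle_dvd : γ ∣ q - e * A
  disc_dvd : d ∣ q + e * (A * B * C)
  jacobiSym_mul : jacobiSym (A * B) q = 1
  jacobiSym_disc : jacobiSym d q = 1

lemma exists_emod_eight_jacobiSym_two {ρ : ℤ} (hρ : ρ ^ 2 = 1) :
    ∃ r : ℤ, IsCoprime r 8 ∧ ∀ q : ℕ, 8 ∣ q - r → q % 4 = 1 ∧ jacobiSym 2 q = ρ := by
  have hJ {q : ℕ} (hq : Odd q) := jacobiSym.at_two hq
  simp only [ZMod.χ₈_nat_eq_if_mod_eight] at hJ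
  rcases sq_eq_one_iff.1 hρ with rfl | rfl
  · refine ⟨1, isCoprime_one_left, fun q hq => ⟨by omega, ?_⟩⟩
    rw [hJ (Nat.odd_iff.2 (by omega)), if_neg (by omega), if_pos (by omega)]
  · refine ⟨5, ⟨5, -3, by norm_num⟩, fun q hq => ⟨by omega, ?_⟩⟩
    rw [hJ (Nat.odd_iff.2 (by omega)), if_neg (by omega), if_neg (by omega)]

lemma IsAuxiliaryFactor.exists_isAuxiliaryPrime {A B C d e γ : ℤ}
    (he : IsAuxiliaryFactor A B C e γ) (h : Admissible A B C) (hd : IsLocallyRepresented A B C d) :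
    ∃ q, IsAuxiliaryPrime A B C d e γ q := by
  have hcop : IsCoprime (A * B * C) d := hd.isCoprime h
  have hdAγ : IsCoprime (A * γ) d :=
    hcop.of_mul_left_left.of_mul_left_left.mul_left
      (he.isCoprime hd.odd hcop.of_mul_left_left.of_mul_left_right.symm).symm
  have hed : IsCoprime e d := he.isCoprime_of_odd hd.odd
  have h8 {n : ℤ} (hn : Odd n) : IsCoprime 8 n := (Int.isCoprime_two_left.2 hn).pow_left (m := 3)
  have hsq : Squarefree (e * (A * B * C) * d) := by
    have hesq : Squarefree e := Int.prime_two.squarefree.squarefree_of_dvd he.dvd_two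
    exact squarefree_mul_iff.2 ⟨(hed.mul_left hcop).isRelPrime, squarefree_mul_iff.2
      ⟨(he.isCoprime_mul h).isRelPrime, hesq, h.squarefree⟩, hd.squarefree⟩
  obtain ⟨r, hr, hr8⟩ :=
    exists_emod_eight_jacobiSym_two (jacobiSym_sq_of_isCoprime (he.isCoprime_sub h))
  obtain ⟨q, hqN, hq, hqdvd⟩ := exists_prime_gt_forall_dvd_sub (n := ![8, A * γ, d])
    (a := ![r, e * (A - B), -(e * (A * B * C))])
    (by simp [Fin.forall_fin_succ, h.pos.ne', he.ne_zero, hd.squarefree.ne_zero])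
    (by simp [Pairwise, Fin.forall_fin_succ, h8 (h.odd_left.mul he.odd), h8 hd.odd, hdAγ,
        (h8 (h.odd_left.mul he.odd)).symm, (h8 hd.odd).symm, hdAγ.symm])
    (by simpa [Fin.forall_fin_succ] using
      ⟨hr, he.isCoprime_sub h, (hed.mul_left hcop).neg_left⟩)
    (e * (A * B * C) * d).natAbs
  obtain ⟨hq8, hqA, hqd⟩ : (8 : ℤ) ∣ q - r ∧ A * γ ∣ q - e * (A - B) ∧
      d ∣ q - -(e * (A * B * C)) := by simpa [Fin.forall_fin_succ] using hqdvd
  obtain ⟨hq4, hq2⟩ := hr8 q hq8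
  rw [sub_neg_eq_add] at hqd
  have hqndvd : ¬ (q : ℤ) ∣ e * (A * B * C) * d := fun hdvd =>
    (Nat.le_of_dvd (Int.natAbs_pos.2 hsq.ne_zero) (Int.natCast_dvd.1 hdvd)).not_gt hqN
  have hqp := Nat.prime_iff_prime_int.1 hq
  refine ⟨q, hq, ?_, ?_, ?_, hqd, he.jacobiSym_mul_eq_one h hq4 hqA hq2,
    he.jacobiSym_eq_one h hd (Nat.odd_iff.2 (by omega)) hqd⟩
  · exact squarefree_mul_iff.2
      ⟨((Prime.coprime_iff_not_dvd hqp).2 hqndvd).symm.isRelPrime, hsq, hqp.squarefree⟩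
  · obtain ⟨u, hu⟩ := hqA
    exact ⟨γ * u + e, by linear_combination hu⟩
  · obtain ⟨⟨u, hu⟩, k, hk⟩ := And.intro hqA he.dvd_middle
    exact ⟨A * u - e * k, by linear_combination hu - e * hk⟩

namespace IsAuxiliaryPrime

variable {A B C d e γ : ℤ} {q : ℕ} (hq : IsAuxiliaryPrime A B C d e γ q)

include hq

lemma factor_mul_ne_zero : e * q ≠ 0 :=
  mul_ne_zero (left_ne_zero_of_mul <| left_ne_zero_of_mul <| left_ne_zero_of_mul
    hq.squarefree.ne_zero) (right_ne_zero_of_mul hq.squarefree.ne_zero)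

lemma eq_of_dvd (he : IsAuxiliaryFactor A B C e γ) {l : ℕ} (hl : l.Prime) (h2 : l ≠ 2)
    (h : (l : ℤ) ∣ e * q) : l = q := by
  have hel := he.isCoprime_of_odd ((Int.odd_coe_nat l).2 (hl.odd_of_ne_two h2))
  exact (Nat.prime_dvd_prime_iff_eq hl hq.prime).1
    (Int.natCast_dvd_natCast.1 (hel.symm.dvd_of_dvd_mul_left h))

theorem isIsotropic_left (h : Admissible A B C) (he : IsAuxiliaryFactor A B C e γ) :
    IsIsotropic A (-B) (-(e * q)) := by
  have hq0 : (0 : ℤ) < q := by exact_mod_cast hq.prime.pos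
  refine IsLegendreTriple.isIsotropic ⟨?_, fun l _ _ hA => ?_, fun l hl h2 hB => ?_,
    fun l hl h2 hw => ?_⟩ ?_ (fun hneg => hneg.1.not_gt h.pos)
  · exact hq.squarefree.squarefree_of_dvd ⟨C * d, by ring⟩
  · obtain ⟨v, hv⟩ := hA.trans hq.left_dvd
    exact isSquare_of_dvd_sub (b := e * B) ⟨-(e * B) * v, by linear_combination -(e * B) * hv⟩
  · obtain ⟨v, hv⟩ := (he.dvd_of_dvd hl h2 (dvd_neg.1 hB)).trans hq.middle_dvd
    exact isSquare_of_dvd_sub (b := e * A) ⟨e * A * v, by linear_combination e * A * hv⟩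
  · obtain rfl := hq.eq_of_dvd he hl h2 (dvd_neg.1 hw)
    exact isSquare_of_jacobiSym_eq_one hl (by simpa using hq.jacobiSym_mul)
  · rintro ⟨-, hB, hw⟩
    nlinarith [he.pos_of_neg (neg_pos.1 hB)]

lemma isSquare_factor (h : Admissible A B C) (he : IsAuxiliaryFactor A B C e γ)
    (hd : IsLocallyRepresented A B C d) {l : ℕ} (hl : l.Prime) (h2 : l ≠ 2)
    (hAB : (l : ℤ) ∣ A * B) : IsSquare ((C * (e * q) * d : ℤ) : ZMod l) := by
  have hsq := h.localSymbol_sq hl (hAB.mul_right C)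
  have hde := hd.jacobiSym_eq l hl h2 (hAB.mul_right C)
  have hee : jacobiSym e l ^ 2 = 1 :=
    jacobiSym_sq_of_isCoprime (he.isCoprime_of_odd ((Int.odd_coe_nat l).2 (hl.odd_of_ne_two h2)))
  suffices hs : ∃ s : ℤ, jacobiSym s l = localSymbol A B C l ∧
      (l : ℤ) ∣ C * (e * q) * d - e * e * s * d by
    obtain ⟨s, hs, hdvd⟩ := hs
    refine isSquare_of_jacobiSym_eq_one hl ?_
    rw [jacobiSym_congr hdvd, jacobiSym.mul_left, jacobiSym.mul_left, jacobiSym.mul_left, hs, hde,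
      ← sq, hee, one_mul, ← sq, hsq]
  rcases (Nat.prime_iff_prime_int.1 hl).dvd_or_dvd hAB with hA | hB
  · obtain ⟨v, hv⟩ := hA.trans hq.left_dvd
    exact ⟨-(B * C), (localSymbol_left hA).symm, C * e * d * v,
      by linear_combination C * e * d * hv⟩
  · obtain ⟨v, hv⟩ := (he.dvd_of_dvd hl h2 hB).trans hq.middle_dvd
    exact ⟨A * C, (h.localSymbol_middle hl hB).symm, C * e * d * v,
      by linear_combination C * e * d * hv⟩

theorem isIsotropic_right (h : Admissible A B C) (he : IsAuxiliaryFactor A B C e γ)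
    (hd : IsLocallyRepresented A B C d) : IsIsotropic (A * B) (C * (e * q)) (-d) := by
  have hq0 : (0 : ℤ) < q := by exact_mod_cast hq.prime.pos
  refine IsLegendreTriple.isIsotropic ⟨?_, fun l hl h2 hAB => ?_, fun l hl h2 hw => ?_,
    fun l _ _ hld => ?_⟩ ?_ ?_
  · exact hq.squarefree.squarefree_of_dvd ⟨-1, by ring⟩
  · simpa using hq.isSquare_factor h he hd hl h2 hAB
  · refine isSquare_of_jacobiSym_eq_one hl ?_
    rw [neg_mul, neg_neg, jacobiSym.mul_left]
    rcases (Nat.prime_iff_prime_int.1 hl).dvd_or_dvd hw with hC | hw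
    · have hABC := hC.mul_left (A * B)
      rw [← h.localSymbol_right hl hC, hd.jacobiSym_eq l hl h2 hABC, ← sq, h.localSymbol_sq hl hABC]
    · obtain rfl := hq.eq_of_dvd he hl h2 hw
      rw [hq.jacobiSym_mul, hq.jacobiSym_disc, one_mul]
  · obtain ⟨v, hv⟩ := (dvd_neg.1 hld).trans hq.disc_dvd
    exact isSquare_of_dvd_sub (b := e * (A * B * C))
      ⟨-(e * (A * B * C)) * v, by linear_combination -(e * (A * B * C)) * hv⟩
  · rintro ⟨hAB, hCw, -⟩
    have hCe := he.neg_of_pos (pos_of_mul_pos_right hAB h.pos.le)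
    nlinarith
  · rintro ⟨hAB, hCw, hd0⟩
    have hB : B < 0 := neg_of_mul_neg_right hAB h.pos.le
    have hC : C < 0 := neg_of_mul_neg_left hCw (mul_pos (he.pos_of_neg hB) hq0).le
    linarith [hd.neg ⟨hAB, mul_neg_of_pos_of_neg h.pos hC⟩]

end IsAuxiliaryPrime

theorem Admissible.represents {A B C d : ℤ} (h : Admissible A B C)
    (hd : IsLocallyRepresented A B C d) :
    ∃ x y z : ℚ, A * B * x ^ 2 + A * C * y ^ 2 - B * C * z ^ 2 = d := by
  obtain ⟨e, γ, he⟩ := h.exists_isAuxiliaryFactor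
  obtain ⟨q, hq⟩ := he.exists_isAuxiliaryPrime h hd
  exact exists_ternary_eq_of_isIsotropic h.pos.ne' h.middle_ne_zero h.right_ne_zero
    hq.factor_mul_ne_zero (hq.isIsotropic_left h he) (hq.isIsotropic_right h he hd)

lemma exists_squarefree_mul_sq {D : ℤ} (hD : D ≠ 0) :
    ∃ d f : ℤ, D = d * f ^ 2 ∧ Squarefree d ∧ f ≠ 0 := by
  obtain ⟨a, b, hab, ha⟩ := Nat.sq_mul_squarefree D.natAbs
  refine ⟨D.sign * a, b, ?_, ?_, ?_⟩
  · rw [← Int.sign_mul_natAbs D, Int.sign_mul, Int.sign_sign, Int.sign_natCast_of_ne_zero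
      (Int.natAbs_ne_zero.2 hD), ← hab]
    push_cast
    ring
  · rw [← Int.squarefree_natAbs, Int.natAbs_mul, Int.natAbs_sign_of_ne_zero hD]
    simpa using ha
  · rintro hb
    rw [Nat.cast_eq_zero.1 hb, zero_pow two_ne_zero, zero_mul] at hab
    exact hD (Int.natAbs_eq_zero.1 hab.symm)

lemma exists_mul_sq_eq_of_mul_sq_eq {l : ℕ} (hl : l.Prime) {d w : ℤ} (hd : Squarefree d) {k : ℕ} :
    ∀ {f : ℤ}, d * f ^ 2 = ((l : ℤ) ^ k) ^ 2 * w → ∃ g : ℤ, d * g ^ 2 = w := by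
  have hli := Nat.prime_iff_prime_int.1 hl
  induction k with
  | zero => exact fun {f} h => ⟨f, by simpa using h⟩
  | succ k ih =>
    intro f h
    have hdvd : (l : ℤ) ^ 1 ∣ f ^ 2 := hd.pow_dvd_of_squarefree_of_pow_succ_dvd_mul_right hli
      ⟨((l : ℤ) ^ k) ^ 2 * w, by rw [h]; ring⟩
    obtain ⟨f', rfl⟩ := hli.dvd_of_dvd_pow (by simpa using hdvd)
    refine ih (f := f') (mul_left_cancel₀ (pow_ne_zero 2 hli.ne_zero) ?_)
    linear_combination h

/-- The integer `D` is an even power of `l` times an integer `w` with Legendre symbol `(w / l) = ε`.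
For `ε = ±1` this says that `D` has even valuation at `l` and its unit part has character `ε`. -/
def HasSymbol (l : ℕ) (ε D : ℤ) : Prop :=
  ∃ (k : ℕ) (w : ℤ), D = ((l : ℤ) ^ k) ^ 2 * w ∧ jacobiSym w l = ε

/-- The integer `D` is an even power of `2` times an integer that is `r` modulo `8`: the analogue of
`HasSymbol` at the prime `2`. -/
def HasResidueTwo (r D : ℤ) : Prop :=
  ∃ (k : ℕ) (w : ℤ), D = ((2 : ℕ) ^ k : ℤ) ^ 2 * w ∧ w % 8 = r

theorem Admissible.represents_of_local {A B C D : ℤ} (h : Admissible A B C)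
    (h2 : HasResidueTwo (if RamifiedTwo A B C then 5 else 1) D)
    (hreal : RamifiedReal A B C → D < 0)
    (hodd : ∀ l : ℕ, l.Prime → l ≠ 2 → (l : ℤ) ∣ A * B * C →
      HasSymbol l (localSymbol A B C l) D) :
    ∃ x y z : ℚ, A * B * x ^ 2 + A * C * y ^ 2 - B * C * z ^ 2 = D := by
  obtain ⟨k, w, hDw, hw⟩ := h2
  have hw_odd : Odd w := Int.odd_iff.2 (by split_ifs at hw <;> omega)
  have hD : D ≠ 0 := by
    rw [hDw]
    exact mul_ne_zero (by positivity) (by rintro rfl; exact absurd hw_odd (by decide))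
  obtain ⟨d, f, rfl, hd, -⟩ := exists_squarefree_mul_sq hD
  suffices hloc : IsLocallyRepresented A B C d by
    obtain ⟨x, y, z, hxyz⟩ := h.represents hloc
    exact ⟨f * x, f * y, f * z, by push_cast; rw [← hxyz]; ring⟩
  refine ⟨hd, ?_, fun hr => ?_, fun l hl hl2 hdvd => ?_⟩
  · obtain ⟨g, rfl⟩ := exists_mul_sq_eq_of_mul_sq_eq Nat.prime_two hd hDw
    have hg : Odd g := (Int.odd_pow' two_ne_zero).1 (Int.odd_mul.1 hw_odd).2
    obtain ⟨v, hv⟩ := Int.eight_dvd_sq_sub_one_of_odd hg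
    rw [← hw]
    exact Int.emod_eq_emod_iff_emod_sub_eq_zero.2 (Int.emod_eq_zero_of_dvd
      ⟨-d * v, by linear_combination -d * hv⟩)
  · exact neg_of_mul_neg_left (hreal hr) (sq_nonneg f)
  · obtain ⟨k, w, hDw, hwl⟩ := hodd l hl hl2 hdvd
    obtain ⟨g, rfl⟩ := exists_mul_sq_eq_of_mul_sq_eq hl hd hDw
    have hsq : jacobiSym (d * g ^ 2) l ^ 2 = 1 := by rw [hwl, h.localSymbol_sq hl hdvd]
    have hg : ¬ (l : ℤ) ∣ g := fun hg =>
      not_dvd_of_jacobiSym_sq hl hsq ((hg.pow two_ne_zero).mul_left _)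
    rw [← hwl, jacobiSym.mul_left, jacobiSym.pow_left, jacobiSym_sq_of_not_dvd hl hg, mul_one]

section FiniteField

variable {F : Type*} [Field F]

lemma add_sq_div_div_two_eq_iff (h2 : (2 : F) ≠ 0) {u v c : F} (hu : u ≠ 0) :
    (u + c ^ 2 / u) / 2 = v ↔ u * (2 * v - u) = c ^ 2 := by
  rw [div_eq_iff h2, ← eq_sub_iff_add_eq', div_eq_iff hu, eq_comm, mul_comm, mul_comm v]

lemma add_sq_div_div_two_eq_iff_of_sq_eq (h2 : (2 : F) ≠ 0) {u e c : F} (hu : u ≠ 0)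
    (he : e ^ 2 = c ^ 2) : (u + c ^ 2 / u) / 2 = e ↔ u = e := by
  rw [add_sq_div_div_two_eq_iff h2 hu, ← he, ← sub_eq_zero, ← sub_eq_zero (a := u),
    ← sq_eq_zero_iff (a := u - e), ← neg_eq_zero]
  ring_nf

open Classical in
/-- The map `u ↦ (u + c² / u) / 2` parametrizes the `v` for which `v² - c²` is a square, and it is
two-to-one away from its ramification points `u = ±c`. -/
lemma two_mul_card_isSquare_sq_sub_sq_sdiff_le [Fintype F] (h2 : (2 : F) ≠ 0) {c : F}
    (hc : c ≠ 0) :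
    2 * ((Finset.univ.filter fun v : F => IsSquare (v ^ 2 - c ^ 2)) \ {c, -c}).card ≤
      (Finset.univ \ {0, c, -c} : Finset F).card := by
  let f (u : F) : F := (u + c ^ 2 / u) / 2
  have hf {u v : F} (hu : u ≠ 0) : f u = v ↔ u * (2 * v - u) = c ^ 2 :=
    add_sq_div_div_two_eq_iff h2 hu
  have hfix {u e : F} (hu : u ≠ 0) (he : e ^ 2 = c ^ 2) : f u = e ↔ u = e :=
    add_sq_div_div_two_eq_iff_of_sq_eq h2 hu he
  refine Finset.mul_card_image_le_card_of_maps_to (f := f) (fun u hu => ?_) 2 fun v hv => ?_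
  · obtain ⟨hu0, huc, hunc⟩ : u ≠ 0 ∧ u ≠ c ∧ u ≠ -c := by simpa using hu
    have hprod := (hf hu0).1 rfl
    have hsq : f u ^ 2 - c ^ 2 = (u - f u) * (u - f u) := by
      generalize f u = v at hprod ⊢
      linear_combination hprod
    simp [hsq, hfix hu0 rfl, hfix hu0 (neg_sq c), huc, hunc]
  · obtain ⟨⟨w, hw⟩, hvc, hvnc⟩ : IsSquare (v ^ 2 - c ^ 2) ∧ v ≠ c ∧ v ≠ -c := by
      simpa using hv
    have hmem {w : F} (hw : v ^ 2 - c ^ 2 = w * w) :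
        v + w ∈ (Finset.univ \ {0, c, -c} : Finset F).filter fun u => f u = v := by
      have hprod : (v + w) * (2 * v - (v + w)) = c ^ 2 := by linear_combination hw
      have hne0 : v + w ≠ 0 := fun h => pow_ne_zero 2 hc (by rw [← hprod, h, zero_mul])
      have hfv := (hf hne0).2 hprod
      have hvw {e : F} (he : e ^ 2 = c ^ 2) (hve : v ≠ e) : v + w ≠ e := fun h =>
        hve (hfv.symm.trans ((hfix hne0 he).2 h))
      simp [hfv, hne0, hvw rfl hvc, hvw (neg_sq c) hvnc]
    have hw0 : w ≠ 0 := by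
      rintro rfl
      exact (sq_eq_sq_iff_eq_or_eq_neg.1 (by linear_combination hw)).elim hvc hvnc
    have hww : v + w ≠ v + -w := fun h => mul_ne_zero h2 hw0 (by linear_combination h)
    rw [← Finset.card_pair hww]
    refine Finset.card_le_card (Finset.insert_subset (hmem hw) ?_)
    exact Finset.singleton_subset_iff.2 (hmem (by rw [hw, neg_mul_neg]))

open Classical in
lemma two_mul_card_isSquare_sq_sub_sq_le [Fintype F] (h2 : (2 : F) ≠ 0) {c : F} (hc : c ≠ 0) :
    2 * (Finset.univ.filter fun v : F => IsSquare (v ^ 2 - c ^ 2)).card ≤ Fintype.card F + 1 := by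
  have hfibre := two_mul_card_isSquare_sq_sub_sq_sdiff_le h2 hc
  set Q := Finset.univ.filter fun v : F => IsSquare (v ^ 2 - c ^ 2)
  have hne : c ≠ -c := fun h => mul_ne_zero h2 hc (by linear_combination h)
  have hcard : ({0, c, -c} : Finset F).card = 3 := by
    rw [Finset.card_insert_of_notMem (by simp [hc.symm, hc]), Finset.card_pair hne]
  have hE := Finset.card_sdiff_add_card_eq_card (Finset.subset_univ ({0, c, -c} : Finset F))
  have hQ := Finset.card_le_card_sdiff_add_card (s := Q) (t := {c, -c})
  rw [Finset.card_pair hne] at hQ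
  rw [Finset.card_univ] at hE
  omega

lemma exists_add_eq_of_not_isSquare [Finite F] (h2 : (2 : F) ≠ 0) {c : F} (hc : c ≠ 0) (t : F) :
    ∃ v, (v = c ∨ ¬ IsSquare (v ^ 2 - c ^ 2)) ∧ (t - v = c ∨ ¬ IsSquare ((t - v) ^ 2 - c ^ 2)) := by
  classical
  have := Fintype.ofFinite F
  have hcard := two_mul_card_isSquare_sq_sub_sq_le h2 hc
  set Q := Finset.univ.filter fun v : F => IsSquare (v ^ 2 - c ^ 2) with hQ
  have hV : (insert c Qᶜ).card = Fintype.card F - Q.card + 1 := by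
    rw [Finset.card_insert_of_notMem (by simp [hQ]), Finset.card_compl]
  have hmem (v : F) : v ∈ insert c Qᶜ ↔ v = c ∨ ¬ IsSquare (v ^ 2 - c ^ 2) := by simp [hQ]
  have himage := Finset.card_image_of_injective (insert c Qᶜ) (sub_right_injective (b := t))
  obtain ⟨v, hv⟩ := Finset.inter_nonempty_of_card_lt_card_add_card
    (Finset.subset_univ (insert c Qᶜ)) (Finset.subset_univ ((insert c Qᶜ).image (t - ·)))
    (by rw [himage, hV, Finset.card_univ]; omega)
  obtain ⟨hv, u, hu, rfl⟩ : v ∈ insert c Qᶜ ∧ ∃ u ∈ insert c Qᶜ, t - u = v := by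
    simpa only [Finset.mem_inter, Finset.mem_image] using hv
  exact ⟨t - u, (hmem _).1 hv, by rw [sub_sub_cancel]; exact (hmem _).1 hu⟩

end FiniteField

section OddPrime

variable {l : ℕ}

lemma jacobiSym_eq_neg_one_iff (hl : l.Prime) (a : ℤ) :
    jacobiSym a l = -1 ↔ ¬ IsSquare (a : ZMod l) := by
  have : Fact l.Prime := ⟨hl⟩
  rw [← jacobiSym.legendreSym.to_jacobiSym]
  exact legendreSym.eq_neg_one_iff l

lemma not_dvd_two_of_prime (hl : l.Prime) (h2 : l ≠ 2) : ¬ (l : ℤ) ∣ 2 := fun h =>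
  h2 ((Nat.prime_dvd_prime_iff_eq hl Nat.prime_two).1 (by exact_mod_cast h))

lemma hasSymbol_of_not_isSquare (hl : l.Prime) {n r v : ℤ} (hr : (l : ℤ) ∣ r - v)
    (hv : ¬ IsSquare ((v ^ 2 - 4 * n ^ 2 : ℤ) : ZMod l)) :
    HasSymbol l (-1) (r ^ 2 - 4 * n ^ 2) := by
  refine ⟨0, r ^ 2 - 4 * n ^ 2, by simp, ?_⟩
  obtain ⟨k, hk⟩ := hr
  rw [jacobiSym_congr (b := v ^ 2 - 4 * n ^ 2) ⟨k * (r + v), by linear_combination (r + v) * hk⟩]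
  exact (jacobiSym_eq_neg_one_iff hl _).2 hv

lemma hasSymbol_of_dvd_sub_two_mul (hl : l.Prime) (h2 : l ≠ 2) {n ω r : ℤ}
    (hω : jacobiSym (n * ω) l = -1) (hr : (l : ℤ) ^ 3 ∣ r - (2 * n + l ^ 2 * ω)) :
    HasSymbol l (-1) (r ^ 2 - 4 * n ^ 2) := by
  obtain ⟨j, hj⟩ := hr
  obtain rfl : r = 2 * n + l ^ 2 * (ω + l * j) := by linear_combination hj
  refine ⟨1, (ω + l * j) * (4 * n + l ^ 2 * (ω + l * j)), by ring, ?_⟩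
  have hdvd : (l : ℤ) ∣ (ω + l * j) * (4 * n + l ^ 2 * (ω + l * j)) - 2 ^ 2 * (n * ω) :=
    ⟨4 * n * j + l * (ω + l * j) ^ 2, by ring⟩
  rw [jacobiSym_congr hdvd, jacobiSym.mul_left, jacobiSym.pow_left,
    jacobiSym_sq_of_not_dvd hl (not_dvd_two_of_prime hl h2), one_mul, hω]

lemma exists_jacobiSym_mul_eq_neg_one (hl : l.Prime) (h2 : l ≠ 2) {n : ℤ}
    (hn : ¬ (l : ℤ) ∣ n) : ∃ ω : ℤ, jacobiSym (n * ω) l = -1 := by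
  have : Fact l.Prime := ⟨hl⟩
  obtain ⟨a, ha⟩ := FiniteField.exists_nonsquare (F := ZMod l) (by rwa [ZMod.ringChar_zmod_n])
  obtain ⟨a, rfl⟩ := ZMod.intCast_surjective a
  refine ⟨n * a, ?_⟩
  rw [← mul_assoc, jacobiSym.mul_left, jacobiSym.mul_left, ← sq, jacobiSym_sq_of_not_dvd hl hn,
    one_mul]
  exact (jacobiSym_eq_neg_one_iff hl a).2 ha

lemma exists_int_add_eq_of_not_isSquare (hl : l.Prime) (h2 : l ≠ 2) {n : ℤ} (hn : ¬ (l : ℤ) ∣ n)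
    (t : ℤ) : ∃ v : ℤ,
      ((l : ℤ) ∣ v - 2 * n ∨ ¬ IsSquare ((v ^ 2 - 4 * n ^ 2 : ℤ) : ZMod l)) ∧
      ((l : ℤ) ∣ t - v - 2 * n ∨ ¬ IsSquare (((t - v) ^ 2 - 4 * n ^ 2 : ℤ) : ZMod l)) := by
  have : Fact l.Prime := ⟨hl⟩
  have hF2 : (2 : ZMod l) ≠ 0 := fun h => not_dvd_two_of_prime hl h2
    ((ZMod.intCast_zmod_eq_zero_iff_dvd _ _).1 (by exact_mod_cast h))
  have hFn : (n : ZMod l) ≠ 0 := fun h => hn ((ZMod.intCast_zmod_eq_zero_iff_dvd _ _).1 h)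
  obtain ⟨v, hv⟩ := exists_add_eq_of_not_isSquare hF2 (mul_ne_zero hF2 hFn) t
  obtain ⟨v, rfl⟩ := ZMod.intCast_surjective v
  have hsq : (2 * n : ZMod l) ^ 2 = 4 * n ^ 2 := by ring
  refine ⟨v, ?_⟩
  simpa only [← ZMod.intCast_zmod_eq_zero_iff_dvd, Int.cast_sub, Int.cast_mul, Int.cast_pow,
    Int.cast_ofNat, sub_eq_zero, hsq] using hv

lemma exists_residue_inert_of_not_dvd (hl : l.Prime) (h2 : l ≠ 2) {n t : ℤ} (hn : ¬ (l : ℤ) ∣ n)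
    (ht : ¬ (l : ℤ) ∣ t - 4 * n) : ∃ r₀ : ℤ, ∀ r : ℤ, (l : ℤ) ^ 3 ∣ r - r₀ →
      HasSymbol l (-1) (r ^ 2 - 4 * n ^ 2) ∧ HasSymbol l (-1) ((t - r) ^ 2 - 4 * n ^ 2) := by
  obtain ⟨ω, hω⟩ := exists_jacobiSym_mul_eq_neg_one hl h2 hn
  have hl3 : (l : ℤ) ∣ (l : ℤ) ^ 3 := dvd_pow_self _ three_ne_zero
  obtain ⟨v, ⟨i, hi⟩ | hv, ⟨j, hj⟩ | hv'⟩ := exists_int_add_eq_of_not_isSquare hl h2 hn t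
  · exact absurd ⟨i + j, by linear_combination hi + hj⟩ ht
  · refine ⟨2 * n + l ^ 2 * ω, fun r hr => ⟨hasSymbol_of_dvd_sub_two_mul hl h2 hω hr, ?_⟩⟩
    obtain ⟨k, hk⟩ := hl3.trans hr
    exact hasSymbol_of_not_isSquare hl ⟨i - k - l * ω, by linear_combination hi - hk⟩ hv'
  · refine ⟨t - (2 * n + l ^ 2 * ω), fun r hr => ⟨?_, hasSymbol_of_dvd_sub_two_mul hl h2 hω ?_⟩⟩
    · obtain ⟨k, hk⟩ := hl3.trans hr
      exact hasSymbol_of_not_isSquare hl ⟨k + j - l * ω, by linear_combination hk + hj⟩ hv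
    · obtain ⟨k, hk⟩ := hr
      exact ⟨-k, by linear_combination -hk⟩
  · refine ⟨v, fun r hr => ⟨hasSymbol_of_not_isSquare hl (hl3.trans hr) hv, ?_⟩⟩
    obtain ⟨k, hk⟩ := hl3.trans hr
    exact hasSymbol_of_not_isSquare hl ⟨-k, by linear_combination -hk⟩ hv'

lemma exists_residue_inert (hl : l.Prime) (h2 : l ≠ 2) {n : ℤ} (hn : ¬ (l : ℤ) ∣ n) (t : ℤ) :
    ∃ r₀ : ℤ, ∀ r : ℤ, (l : ℤ) ^ 3 ∣ r - r₀ →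
      HasSymbol l (-1) (r ^ 2 - 4 * n ^ 2) ∧ HasSymbol l (-1) ((t - r) ^ 2 - 4 * n ^ 2) := by
  by_cases ht : (l : ℤ) ∣ t - 4 * n
  · have ht' : ¬ (l : ℤ) ∣ t - 4 * -n := fun ht' => by
      obtain ⟨⟨i, hi⟩, j, hj⟩ := And.intro ht' ht
      have h8 : (l : ℤ) ∣ 2 ^ 3 * n := ⟨i - j, by linear_combination hi - hj⟩
      have hli := Nat.prime_iff_prime_int.1 hl
      exact (hli.dvd_or_dvd h8).elim
        (fun h => not_dvd_two_of_prime hl h2 (hli.dvd_of_dvd_pow h)) hn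
    simpa only [neg_sq] using exists_residue_inert_of_not_dvd hl h2 (mt dvd_neg.1 hn) ht'
  · exact exists_residue_inert_of_not_dvd hl h2 hn ht

lemma hasSymbol_one_of_dvd {n r : ℤ} (hn : (l : ℤ) ∣ n) (hr : (l : ℤ) ∣ r ^ 2 - 1) :
    HasSymbol l 1 (r ^ 2 - 4 * n ^ 2) := by
  refine ⟨0, r ^ 2 - 4 * n ^ 2, by simp, ?_⟩
  obtain ⟨⟨a, ha⟩, b, hb⟩ := And.intro hn hr
  rw [jacobiSym_congr (b := 1) ⟨b - 4 * a * n, by linear_combination hb - 4 * n * ha⟩,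
    jacobiSym.one_left]

end OddPrime

section Two

variable {n r : ℤ}

lemma sq_emod_eight (hn : n % 2 = 1) : n ^ 2 % 8 = 1 := by
  have := Int.eight_dvd_sq_sub_one_of_odd (Int.odd_iff.2 hn)
  omega

lemma hasResidueTwo_five_of_odd (hn : n % 2 = 1) (hr : r % 2 = 1) :
    HasResidueTwo 5 (r ^ 2 - 4 * n ^ 2) := by
  refine ⟨0, r ^ 2 - 4 * n ^ 2, by simp, ?_⟩
  have := sq_emod_eight hn
  have := sq_emod_eight hr
  omega

/-- Here `18 n` is a solution of `r² - 4 n² ≡ 2⁶ · 5 n²`. -/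
lemma hasResidueTwo_five_of_dvd_sub (hn : n % 2 = 1) (hr : (2 : ℤ) ^ 7 ∣ r - 18 * n) :
    HasResidueTwo 5 (r ^ 2 - 4 * n ^ 2) := by
  obtain ⟨j, hj⟩ := hr
  obtain rfl : r = 18 * n + 128 * j := by linear_combination hj
  refine ⟨3, 5 * n ^ 2 + 8 * (9 * n * j + 32 * j ^ 2), by push_cast; ring, ?_⟩
  have := sq_emod_eight hn
  omega

lemma hasResidueTwo_one (hn : n % 2 = 0) (hr : r % 2 = 1) :
    HasResidueTwo 1 (r ^ 2 - 4 * n ^ 2) := by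
  refine ⟨0, r ^ 2 - 4 * n ^ 2, by simp, ?_⟩
  obtain ⟨m, rfl⟩ := Int.even_iff.2 hn
  have := sq_emod_eight hr
  ring_nf
  omega

lemma exists_residue_inert_two (hn : n % 2 = 1) (t : ℤ) :
    ∃ r₀ : ℤ, ∀ r : ℤ, (2 : ℤ) ^ 7 ∣ r - r₀ →
      HasResidueTwo 5 (r ^ 2 - 4 * n ^ 2) ∧ HasResidueTwo 5 ((t - r) ^ 2 - 4 * n ^ 2) := by
  by_cases ht : t % 2 = 0
  · exact ⟨1, fun r hr => ⟨hasResidueTwo_five_of_odd hn (by omega),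
      hasResidueTwo_five_of_odd hn (by omega)⟩⟩
  · exact ⟨18 * n, fun r hr => ⟨hasResidueTwo_five_of_dvd_sub hn hr,
      hasResidueTwo_five_of_odd hn (by omega)⟩⟩

end Two

lemma mem_Zloc_iff {l : ℕ} {x : ℚ} : x ∈ Zloc l ↔ ¬ l ∣ x.den := by
  refine ⟨?_, fun h => ⟨x.num, x.den, by exact_mod_cast h, (Rat.num_div_den x).symm⟩⟩
  rintro ⟨m, n, hn, rfl⟩ hd
  rw [← Rat.divInt_eq_div] at hd
  exact hn ((Int.natCast_dvd_natCast.2 hd).trans (Rat.den_dvd m n))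

lemma exists_forall_pow_dvd_sub {s : Finset ℕ} (hs : ∀ l ∈ s, l.Prime) (a : ℕ → ℤ) (k : ℕ) :
    ∃ r : ℤ, 0 ≤ r ∧ r < ∏ l ∈ s, (l : ℤ) ^ k ∧ ∀ l ∈ s, (l : ℤ) ^ k ∣ r - a l := by
  obtain ⟨y, hy⟩ := IsDedekindDomain.exists_forall_sub_mem_ideal
    (fun l : ℕ => Ideal.span {(l : ℤ)}) (fun _ => k)
    (fun l hl => Ideal.prime_span_singleton_iff.2 (Nat.prime_iff_prime_int.1 (hs l hl)))
    (fun l _ l' _ hne h => hne (by simpa [Int.natAbs_eq_natAbs_iff, Int.associated_iff_natAbs,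
      Ideal.span_singleton_eq_span_singleton] using h)) (fun l : s => a l)
  have hpos : 0 < ∏ l ∈ s, (l : ℤ) ^ k :=
    Finset.prod_pos fun l hl => pow_pos (Int.natCast_pos.2 (hs l hl).pos) k
  refine ⟨_, Int.emod_nonneg y hpos.ne', Int.emod_lt_of_pos y hpos, fun l hl => ?_⟩
  have hyl : (l : ℤ) ^ k ∣ y - a l := by
    simpa only [Ideal.span_singleton_pow, Ideal.mem_span_singleton] using hy l hl
  have hdvd := (Finset.dvd_prod_of_mem (fun l : ℕ => (l : ℤ) ^ k) hl).trans
    (Int.dvd_sub_self_of_emod_eq rfl : _ ∣ y % (∏ l ∈ s, (l : ℤ) ^ k) - y)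
  simpa using dvd_add hdvd hyl

lemma exists_eq_div_of_mem_Zloc {u v : Finset ℕ} (huv : Disjoint u v) (hu : ∀ l ∈ u, l.Prime)
    (hv : ∀ l ∈ v, l.Prime) {t : ℚ} (ht : ∀ l ∈ u, t ∈ Zloc l) {M : ℤ} (hM : 0 < M)
    (huM : ∀ l ∈ u, (l : ℤ) ∣ M) :
    ∃ n t₀ : ℤ, M ≤ n ∧ t = t₀ / n ∧ (∀ l ∈ u, ¬ (l : ℤ) ∣ n) ∧
      ∀ l ∈ v, (l : ℤ) ∣ n ∧ (l : ℤ) ∣ t₀ := by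
  have hN : 0 < ∏ l ∈ v, (l : ℤ) :=
    Finset.prod_pos fun l hl => Int.natCast_pos.2 (hv l hl).pos
  have hvN (l : ℕ) (hl : l ∈ v) : (l : ℤ) ∣ (∏ l ∈ v, (l : ℤ)) * (1 + M) :=
    (Finset.dvd_prod_of_mem _ hl).mul_right _
  refine ⟨t.den * ((∏ l ∈ v, (l : ℤ)) * (1 + M)), t.num * ((∏ l ∈ v, (l : ℤ)) * (1 + M)), ?_, ?_,
    fun l hl hdvd => ?_, fun l hl => ⟨(hvN l hl).mul_left _, (hvN l hl).mul_left _⟩⟩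
  · have hden : (1 : ℤ) ≤ t.den := by exact_mod_cast t.den_pos
    have hpos : 1 ≤ t.den * ∏ l ∈ v, (l : ℤ) := one_le_mul_of_one_le_of_one_le hden hN
    nlinarith
  · have hne : (((∏ l ∈ v, (l : ℤ)) * (1 + M) : ℤ) : ℚ) ≠ 0 := by
      exact_mod_cast (mul_pos hN (by omega)).ne'
    rw [Int.cast_mul, Int.cast_mul _ (_ * _), mul_div_mul_right _ _ hne, Int.cast_natCast,
      Rat.num_div_den]
  · have hli := Nat.prime_iff_prime_int.1 (hu l hl)
    obtain hdvd | hdvd | hdvd := (hli.dvd_or_dvd hdvd).imp_right hli.dvd_or_dvd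
    · exact mem_Zloc_iff.1 (ht l hl) (Int.natCast_dvd_natCast.1 hdvd)
    · obtain ⟨p, hp, hlp⟩ := (Prime.dvd_finsetProd_iff hli _).1 hdvd
      have := (Nat.prime_dvd_prime_iff_eq (hu l hl) (hv p hp)).1 (Int.natCast_dvd_natCast.1 hlp)
      exact Finset.disjoint_left.1 huv hl (this ▸ hp)
    · exact hli.not_dvd_one ((dvd_add_left (huM l hl)).1 hdvd)

/-- The quaternion algebra `(AB, AC)` is ramified at the prime `l`. -/
def Ramified (A B C : ℤ) (l : ℕ) : Prop :=
  l.Prime ∧ if l = 2 then RamifiedTwo A B C else localSymbol A B C l = -1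

lemma Ramified.dvd {A B C : ℤ} {l : ℕ} (hr : Ramified A B C l) (h2 : l ≠ 2) :
    (l : ℤ) ∣ A * B * C := by
  have hsymb := hr.2
  rw [if_neg h2, localSymbol] at hsymb
  split_ifs at hsymb with hA hB hC
  · exact (hA.mul_right B).mul_right C
  · exact (hB.mul_left A).mul_right C
  · exact hC.mul_left (A * B)

/-- The primes dividing `2ABC`, which contain all ramified primes. -/
def badPrimes (A B C : ℤ) : Finset ℕ := (2 * (A * B * C)).natAbs.primeFactors

/-- The integer `D` has, at the prime `l`, the square class prescribed by the algebra `(AB, AC)`: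
that of the unramified quadratic extension if the algebra is ramified at `l`, and that of the
squares otherwise. -/
def HasPrescribedClass (A B C : ℤ) (l : ℕ) (D : ℤ) : Prop :=
  if l = 2 then HasResidueTwo (if RamifiedTwo A B C then 5 else 1) D
  else HasSymbol l (localSymbol A B C l) D

section Discriminant

variable {A B C r n : ℤ}

lemma div_mem_S_of_represents (hA : A ≠ 0) (hn : n ≠ 0)
    (h : ∃ x y z : ℚ, A * B * x ^ 2 + A * C * y ^ 2 - B * C * z ^ 2 =
      ((r ^ 2 - 4 * n ^ 2 : ℤ) : ℚ)) : (r / n : ℚ) ∈ S (A * B) (A * C) := by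
  obtain ⟨x, y, z, h⟩ := h
  have hA' : (A : ℚ) ≠ 0 := Int.cast_ne_zero.2 hA
  have hn' : (n : ℚ) ≠ 0 := Int.cast_ne_zero.2 hn
  refine ⟨r / (2 * n), x / (2 * n), y / (2 * n), z / (2 * n * A), ?_, by field_simp⟩
  push_cast at h
  field_simp
  linear_combination -h

lemma prime_of_mem_badPrimes {l : ℕ} (hl : l ∈ badPrimes A B C) : l.Prime :=
  Nat.prime_of_mem_primeFactors hl

namespace Admissible

variable (h : Admissible A B C) {l : ℕ}

include h

lemma mem_badPrimes_iff : l ∈ badPrimes A B C ↔ l.Prime ∧ (l = 2 ∨ (l : ℤ) ∣ A * B * C) := by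
  have hne : (2 * (A * B * C)).natAbs ≠ 0 :=
    Int.natAbs_ne_zero.2 (mul_ne_zero two_ne_zero h.squarefree.ne_zero)
  rw [badPrimes, Nat.mem_primeFactors_of_ne_zero hne, and_congr_right_iff]
  intro hl
  rw [← Int.natCast_dvd, (Nat.prime_iff_prime_int.1 hl).dvd_mul,
    ← Nat.prime_dvd_prime_iff_eq hl Nat.prime_two, ← Int.natCast_dvd_natCast, Nat.cast_ofNat]

lemma div_mem_S (hn : n ≠ 0) (hreal : RamifiedReal A B C → r ^ 2 < 4 * n ^ 2)
    (hclass : ∀ l ∈ badPrimes A B C, HasPrescribedClass A B C l (r ^ 2 - 4 * n ^ 2)) :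
    (r / n : ℚ) ∈ S (A * B) (A * C) := by
  refine div_mem_S_of_represents h.pos.ne' hn (h.represents_of_local ?_
    (fun hr => sub_neg.2 (hreal hr)) fun l hl h2 hdvd => ?_)
  · simpa only [HasPrescribedClass, if_true] using
      hclass 2 (h.mem_badPrimes_iff.2 ⟨Nat.prime_two, .inl rfl⟩)
  · simpa only [HasPrescribedClass, if_neg h2] using
      hclass l (h.mem_badPrimes_iff.2 ⟨hl, .inr hdvd⟩)

lemma hasPrescribedClass_of_not_ramified (hl : l ∈ badPrimes A B C) (hr : ¬ Ramified A B C l)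
    (hn : (l : ℤ) ∣ n) (hrl : (l : ℤ) ∣ r ^ 2 - 1) :
    HasPrescribedClass A B C l (r ^ 2 - 4 * n ^ 2) := by
  have hlp := prime_of_mem_badPrimes hl
  rw [Ramified, and_iff_right hlp] at hr
  unfold HasPrescribedClass
  split_ifs at hr ⊢ with h2
  · subst h2
    have hr1 : Odd (r ^ 2) := by
      rw [← Int.not_even_iff_odd, even_iff_two_dvd]
      intro heven
      push_cast at hrl
      omega
    exact hasResidueTwo_one (Int.emod_eq_zero_of_dvd hn)
      (Int.odd_iff.1 ((Int.odd_pow' two_ne_zero).1 hr1))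
  · have hdvd := ((h.mem_badPrimes_iff.1 hl).2).resolve_left h2
    rw [h.localSymbol_eq_one_of_ne hlp hdvd hr]
    exact hasSymbol_one_of_dvd hn hrl

end Admissible

lemma Ramified.exists_residue {l : ℕ} (hr : Ramified A B C l) (hn : ¬ (l : ℤ) ∣ n) (t : ℤ) :
    ∃ r₀ : ℤ, ∀ r : ℤ, (l : ℤ) ^ 7 ∣ r - r₀ → HasPrescribedClass A B C l (r ^ 2 - 4 * n ^ 2) ∧
      HasPrescribedClass A B C l ((t - r) ^ 2 - 4 * n ^ 2) := by
  obtain ⟨hl, hr⟩ := hr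
  unfold HasPrescribedClass
  split_ifs at hr ⊢ with h2
  · subst h2
    exact exists_residue_inert_two (Int.emod_two_ne_zero.1 (mt Int.dvd_of_emod_eq_zero hn)) t
  · rw [hr]
    obtain ⟨r₀, hr₀⟩ := exists_residue_inert hl h2 hn t
    exact ⟨r₀, fun r hr => hr₀ r ((pow_dvd_pow _ (by norm_num)).trans hr)⟩

end Discriminant

section Trace

variable {A B C : ℤ} (h : Admissible A B C)

include h

lemma Admissible.exists_residue {l : ℕ} {n t : ℤ} (hl : l ∈ badPrimes A B C)
    (hram : Ramified A B C l → ¬ (l : ℤ) ∣ n)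
    (hunr : ¬ Ramified A B C l → (l : ℤ) ∣ n ∧ (l : ℤ) ∣ t) :
    ∃ r₀ : ℤ, ∀ r : ℤ, (l : ℤ) ^ 7 ∣ r - r₀ → HasPrescribedClass A B C l (r ^ 2 - 4 * n ^ 2) ∧
      HasPrescribedClass A B C l ((t - r) ^ 2 - 4 * n ^ 2) := by
  by_cases hr : Ramified A B C l
  · exact hr.exists_residue (hram hr) t
  obtain ⟨hn, j, hj⟩ := hunr hr
  refine ⟨1, fun r hr1 => ?_⟩
  obtain ⟨i, hi⟩ := (dvd_pow_self (l : ℤ) (by norm_num : 7 ≠ 0)).trans hr1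
  exact ⟨h.hasPrescribedClass_of_not_ramified hl hr hn
      ⟨i * (r + 1), by linear_combination (r + 1) * hi⟩,
    h.hasPrescribedClass_of_not_ramified hl hr hn ⟨i * (r + 1) + j * (t - 2 * r),
      by linear_combination (r + 1) * hi + (t - 2 * r) * hj⟩⟩

/-- Writing `t = r / n + (t₀ - r) / n`, both summands are traces of norm-one elements as soon as the
discriminants `r² - 4 n²` and `(t₀ - r)² - 4 n²` have the prescribed classes at all bad primes. -/
theorem Admissible.mem_T {t : ℚ} (ht : ∀ l, Ramified A B C l → t ∈ Zloc l)
    (hreal : RamifiedReal A B C → |t| ≤ 1) : t ∈ T (A * B) (A * C) := by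
  classical
  have hprime {l : ℕ} (hl : l ∈ badPrimes A B C) : l.Prime := prime_of_mem_badPrimes hl
  let L := ∏ l ∈ badPrimes A B C, (l : ℤ) ^ 7
  have hL : 0 < L := Finset.prod_pos fun l hl => pow_pos (Int.natCast_pos.2 (hprime hl).pos) 7
  obtain ⟨n, t₀, hLn, rfl, hram, hunr⟩ := exists_eq_div_of_mem_Zloc
    (Finset.disjoint_filter_filter_not (badPrimes A B C) (badPrimes A B C) (Ramified A B C))
    (fun l hl => hprime (Finset.mem_of_mem_filter l hl))
    (fun l hl => hprime (Finset.mem_of_mem_filter l hl))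
    (fun l hl => ht l (Finset.mem_filter.1 hl).2) hL
    (fun l hl => (dvd_pow_self (l : ℤ) (by norm_num)).trans
      (Finset.dvd_prod_of_mem _ (Finset.mem_of_mem_filter l hl)))
  have hresidue (l : ℕ) (hl : l ∈ badPrimes A B C) := h.exists_residue hl
    (fun hr => hram l (Finset.mem_filter.2 ⟨hl, hr⟩))
    (fun hr => hunr l (Finset.mem_filter.2 ⟨hl, hr⟩))
  choose! r₀ hr₀ using hresidue
  obtain ⟨r, hr_nonneg, hrL, hr⟩ := exists_forall_pow_dvd_sub (fun l => hprime) r₀ 7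
  have hn : 0 < n := hL.trans_le hLn
  have hnQ : (0 : ℚ) < n := Int.cast_pos.2 hn
  have hbound (hR : RamifiedReal A B C) : |t₀| ≤ n := by
    have := hreal hR
    rw [abs_div, abs_of_pos hnQ, div_le_one hnQ] at this
    exact_mod_cast this
  refine Set.mem_add.2 ⟨r / n, h.div_mem_S hn.ne' (fun _ => by nlinarith [hrL.trans_le hLn])
      fun l hl => (hr₀ l hl r (hr l hl)).1,
    (t₀ - r : ℤ) / n, h.div_mem_S hn.ne' (fun hR => ?_) fun l hl => (hr₀ l hl r (hr l hl)).2, ?_⟩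
  · have := abs_le.1 (hbound hR)
    nlinarith
  · rw [Int.cast_sub, ← add_div, add_sub_cancel]

end Trace

lemma exists_primitive_common_denominator {ι : Type*} [Finite ι] (x : ι → ℚ) {l : ℕ}
    (hl : 1 < l) : ∃ (X : ι → ℤ) (W : ℤ), W ≠ 0 ∧ (∀ i, x i = X i / W) ∧
      ¬ ((∀ i, (l : ℤ) ∣ X i) ∧ (l : ℤ) ∣ W) := by
  classical
  have hex : ∃ W : ℕ, W ≠ 0 ∧ ∃ X : ι → ℤ, ∀ i, x i = X i / W := by
    cases nonempty_fintype ι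
    have hden (i : ι) : ((x i).den : ℚ) ≠ 0 := Nat.cast_ne_zero.2 (x i).den_nz
    refine ⟨∏ i, (x i).den, Finset.prod_ne_zero_iff.2 fun i _ => (x i).den_nz,
      fun i => (x i).num * ∏ j ∈ Finset.univ.erase i, ((x j).den : ℤ), fun i => ?_⟩
    rw [← Finset.mul_prod_erase _ _ (Finset.mem_univ i)]
    push_cast
    rw [mul_div_mul_right _ _ (Finset.prod_ne_zero_iff.2 fun j _ => hden j), Rat.num_div_den]
  obtain ⟨hW, X, hX⟩ := Nat.find_spec hex
  refine ⟨X, (Nat.find hex : ℕ), Int.natCast_ne_zero.2 hW, by simpa using hX, ?_⟩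
  rintro ⟨hdX, hdW⟩
  choose Y hY using hdX
  obtain ⟨V, hV⟩ := Int.natCast_dvd_natCast.1 hdW
  have hV0 : V ≠ 0 := right_ne_zero_of_mul (hV ▸ hW)
  have hlt : V < Nat.find hex := hV ▸ lt_mul_of_one_lt_left (Nat.pos_of_ne_zero hV0) hl
  refine Nat.find_min hex hlt ⟨hV0, Y, fun i => ?_⟩
  rw [hX i, hY i, hV, Int.cast_mul, Nat.cast_mul, Int.cast_natCast,
    mul_div_mul_left _ _ (Nat.cast_ne_zero.2 (by omega))]

lemma exists_primitive_of_mem_S {A B C : ℤ} {l : ℕ} (hl : 1 < l) {s : ℚ}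
    (hs : s ∈ S (A * B) (A * C)) : ∃ X₁ X₂ X₃ X₄ W : ℤ, W ≠ 0 ∧ s = (2 * X₁ : ℤ) / W ∧
      X₁ ^ 2 - A * B * X₂ ^ 2 - A * C * X₃ ^ 2 + B * C * X₄ ^ 2 = W ^ 2 ∧
      ¬ (((l : ℤ) ∣ X₁ ∧ (l : ℤ) ∣ X₂ ∧ (l : ℤ) ∣ X₃ ∧ (l : ℤ) ∣ X₄) ∧ (l : ℤ) ∣ W) := by
  obtain ⟨x₁, x₂, x₃, x₄, hx, rfl⟩ := hs
  obtain ⟨X, W, hW, hX, hprim⟩ := exists_primitive_common_denominator ![x₁, x₂, x₃, A * x₄] hl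
  simp only [Fin.forall_fin_succ, Matrix.cons_val_zero, Matrix.cons_val_succ, IsEmpty.forall_iff,
    and_true] at hX hprim
  obtain ⟨rfl, rfl, rfl, h4⟩ := hX
  refine ⟨X 0, X 1, X 2, X 3, W, hW, by push_cast; ring, ?_, hprim⟩
  have hWQ : (W : ℚ) ≠ 0 := Int.cast_ne_zero.2 hW
  have hx' : (X 0 / W : ℚ) ^ 2 - A * B * (X 1 / W) ^ 2 - A * C * (X 2 / W) ^ 2 +
      B * C * (X 3 / W) ^ 2 = 1 := by
    have h4' : (A * x₄ : ℚ) = X 3 / W := h4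
    rw [← h4', ← hx]
    simp only [Fin.succ_zero_eq_one, Fin.succ_one_eq_two]
    ring
  field_simp at hx'
  exact_mod_cast hx'

section OddPrime

variable {l : ℕ}

lemma dvd_and_dvd_of_dvd_sq_sub_mul_sq (hl : l.Prime) {m X Y : ℤ} (hm : jacobiSym m l = -1)
    (h : (l : ℤ) ∣ X ^ 2 - m * Y ^ 2) : (l : ℤ) ∣ X ∧ (l : ℤ) ∣ Y := by
  have : Fact l.Prime := ⟨hl⟩
  have hns := (jacobiSym_eq_neg_one_iff hl m).1 hm
  simp only [← ZMod.intCast_zmod_eq_zero_iff_dvd] at h ⊢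
  push_cast at h
  have hY : (Y : ZMod l) = 0 := by
    by_contra hY
    refine hns ⟨X / Y, ?_⟩
    field_simp
    linear_combination -h
  refine ⟨pow_eq_zero_iff two_ne_zero |>.1 ?_, hY⟩
  linear_combination h + m * Y * hY

/-- The norm form of a quaternion algebra that is ramified at `l` is anisotropic at `l`. -/
lemma dvd_of_norm_form_eq_sq (hl : l.Prime) {p q e X Y Z V W : ℤ}
    (hm : jacobiSym (-(p * q)) l = -1) (he : (l : ℤ) ∣ e) (he2 : ¬ (l : ℤ) * l ∣ e)
    (h : X ^ 2 + p * q * Y ^ 2 - e * (p * Z ^ 2 + q * V ^ 2) = W ^ 2) (hW : (l : ℤ) ∣ W) :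
    (l : ℤ) ∣ X ∧ (l : ℤ) ∣ Y ∧ (l : ℤ) ∣ Z ∧ (l : ℤ) ∣ V := by
  have hli := Nat.prime_iff_prime_int.1 hl
  obtain ⟨⟨e, rfl⟩, W, rfl⟩ := And.intro he hW
  obtain ⟨hX, hY⟩ := dvd_and_dvd_of_dvd_sq_sub_mul_sq hl hm (X := X) (Y := Y)
    ⟨e * (p * Z ^ 2 + q * V ^ 2) + l * W ^ 2, by linear_combination h⟩
  refine ⟨hX, hY, ?_⟩
  obtain ⟨⟨X, rfl⟩, Y, rfl⟩ := And.intro hX hY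
  have hdvd : (l : ℤ) ∣ e * (p * Z ^ 2 + q * V ^ 2) := by
    refine ⟨X ^ 2 + p * q * Y ^ 2 - W ^ 2, mul_left_cancel₀ hli.ne_zero ?_⟩
    linear_combination -h
  obtain ⟨k, hk⟩ := (hli.dvd_or_dvd hdvd).resolve_left fun h => he2 (mul_dvd_mul_left _ h)
  have hp : ¬ (l : ℤ) ∣ p := fun hp => not_dvd_of_jacobiSym_sq hl (a := -(p * q))
    (by rw [hm]; norm_num) (dvd_neg.2 (hp.mul_right q))
  obtain ⟨hZ, hV⟩ := dvd_and_dvd_of_dvd_sq_sub_mul_sq hl hm (X := p * Z) (Y := V)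
    ⟨p * k, by linear_combination p * hk⟩
  exact ⟨(hli.dvd_or_dvd hZ).resolve_left hp, hV⟩

lemma Admissible.dvd_of_norm_eq_sq {A B C X₁ X₂ X₃ X₄ W : ℤ} (h : Admissible A B C)
    (hl : Ramified A B C l) (h2 : l ≠ 2)
    (hX : X₁ ^ 2 - A * B * X₂ ^ 2 - A * C * X₃ ^ 2 + B * C * X₄ ^ 2 = W ^ 2) (hW : (l : ℤ) ∣ W) :
    (l : ℤ) ∣ X₁ ∧ (l : ℤ) ∣ X₂ ∧ (l : ℤ) ∣ X₃ ∧ (l : ℤ) ∣ X₄ := by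
  have hdvd := hl.dvd h2
  obtain ⟨hlp, hr⟩ := hl
  rw [if_neg h2] at hr
  have hli := Nat.prime_iff_prime_int.1 hlp
  have hsq {x : ℤ} (hx : x ∣ A * B * C) : ¬ (l : ℤ) * l ∣ x := fun hd =>
    hli.not_isUnit (h.squarefree _ (hd.trans hx))
  rcases hli.dvd_or_dvd hdvd with hd | hC
  · rcases hli.dvd_or_dvd hd with hA | hB
    · rw [localSymbol_left hA] at hr
      obtain ⟨d₁, d₄, d₂, d₃⟩ := dvd_of_norm_form_eq_sq hlp (X := X₁) (Y := X₄) (Z := X₂) (V := X₃)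
        hr hA (hsq ⟨B * C, mul_assoc A B C⟩) (by linear_combination hX) hW
      exact ⟨d₁, d₂, d₃, d₄⟩
    · rw [h.localSymbol_middle hlp hB, show A * C = -(A * -C) by ring] at hr
      obtain ⟨d₁, d₃, d₂, d₄⟩ := dvd_of_norm_form_eq_sq hlp (X := X₁) (Y := X₃) (Z := X₂) (V := X₄)
        hr hB (hsq ⟨A * C, by ring⟩) (by linear_combination hX) hW
      exact ⟨d₁, d₂, d₃, d₄⟩
  · rw [h.localSymbol_right hlp hC, show A * B = -(A * -B) by ring] at hr
    exact dvd_of_norm_form_eq_sq hlp hr hC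
      (hsq (dvd_mul_left C (A * B))) (by linear_combination hX) hW

end OddPrime

section Two

set_option maxRecDepth 100000 in
lemma anisotropic_mod_sixteen : ∀ p ∈ ([(15, 3), (15, 7), (15, 11), (15, 15),
      (2, 3), (2, 5), (2, 11), (2, 13), (14, 5), (14, 7), (14, 13), (14, 15)] :
        List (ZMod 16 × ZMod 16)),
    ∀ x ∈ ([0, 1, 4, 9] : List (ZMod 16)), ∀ y ∈ ([0, 1, 4, 9] : List (ZMod 16)),
    ∀ z ∈ ([0, 1, 4, 9] : List (ZMod 16)), ∀ v ∈ ([0, 1, 4, 9] : List (ZMod 16)),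
      x - p.1 * y - p.2 * z + p.1 * p.2 * v = 0 →
      4 * x = 0 ∧ 4 * y = 0 ∧ 4 * z = 0 ∧ 4 * v = 0 := by
  decide

lemma sq_mem_zmod_sixteen : ∀ x : ZMod 16, x ^ 2 ∈ ([0, 1, 4, 9] : List (ZMod 16)) := by
  decide

lemma two_dvd_of_four_mul_sq_eq_zero {x : ℤ} (hx : 4 * (x : ZMod 16) ^ 2 = 0) : 2 ∣ x := by
  obtain ⟨k, hk⟩ := (ZMod.intCast_zmod_eq_zero_iff_dvd (4 * x ^ 2) 16).1 (by exact_mod_cast hx)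
  exact Int.prime_two.dvd_of_dvd_pow (n := 2) ⟨2 * k, by push_cast at hk; linarith⟩

lemma two_dvd_of_sixteen_dvd_norm_form {m b X Y Z V : ℤ}
    (h : (m % 16 = 15 ∧ b % 4 = 3) ∨ (m % 16 = 2 ∧ (b % 8 = 3 ∨ b % 8 = 5)) ∨
      (m % 16 = 14 ∧ (b % 8 = 5 ∨ b % 8 = 7)))
    (hX : 16 ∣ X ^ 2 - m * Y ^ 2 - b * Z ^ 2 + m * b * V ^ 2) :
    2 ∣ X ∧ 2 ∣ Y ∧ 2 ∣ Z ∧ 2 ∣ V := by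
  have hcast {x r : ℤ} (hx : x % 16 = r) : (x : ZMod 16) = r := by
    rw [← hx]
    exact (ZMod.intCast_mod x 16).symm
  have hmb : ((m : ZMod 16), (b : ZMod 16)) ∈ ([(15, 3), (15, 7), (15, 11), (15, 15),
      (2, 3), (2, 5), (2, 11), (2, 13), (14, 5), (14, 7), (14, 13), (14, 15)] :
        List (ZMod 16 × ZMod 16)) := by
    rcases h with ⟨hm, hb⟩ | ⟨hm, hb⟩ | ⟨hm, hb⟩
    · have hb : b % 16 = 3 ∨ b % 16 = 7 ∨ b % 16 = 11 ∨ b % 16 = 15 := by omega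
      rcases hb with hb | hb | hb | hb <;> rw [hcast hm, hcast hb] <;> decide
    · have hb : b % 16 = 3 ∨ b % 16 = 5 ∨ b % 16 = 11 ∨ b % 16 = 13 := by omega
      rcases hb with hb | hb | hb | hb <;> rw [hcast hm, hcast hb] <;> decide
    · have hb : b % 16 = 5 ∨ b % 16 = 7 ∨ b % 16 = 13 ∨ b % 16 = 15 := by omega
      rcases hb with hb | hb | hb | hb <;> rw [hcast hm, hcast hb] <;> decide
  have hzero : (X : ZMod 16) ^ 2 - m * Y ^ 2 - b * Z ^ 2 + m * b * V ^ 2 = 0 := by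
    exact_mod_cast (ZMod.intCast_zmod_eq_zero_iff_dvd _ 16).2 hX
  exact (anisotropic_mod_sixteen _ hmb _ (sq_mem_zmod_sixteen X) _ (sq_mem_zmod_sixteen Y) _
    (sq_mem_zmod_sixteen Z) _ (sq_mem_zmod_sixteen V) hzero).imp two_dvd_of_four_mul_sq_eq_zero
    (And.imp two_dvd_of_four_mul_sq_eq_zero
      (And.imp two_dvd_of_four_mul_sq_eq_zero two_dvd_of_four_mul_sq_eq_zero))

lemma Admissible.two_dvd_of_norm_eq_sq {A B C X₁ X₂ X₃ X₄ W : ℤ} (h : Admissible A B C)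
    (hr : RamifiedTwo A B C)
    (hX : X₁ ^ 2 - A * B * X₂ ^ 2 - A * C * X₃ ^ 2 + B * C * X₄ ^ 2 = W ^ 2) (hW : 4 ∣ W) :
    2 ∣ X₁ ∧ 2 ∣ X₂ ∧ 2 ∣ X₃ ∧ 2 ∣ X₄ := by
  have hclass : (A * B % 16 = 15 ∧ A * C % 4 = 3) ∨
      (A * B % 16 = 2 ∧ (A * C % 8 = 3 ∨ A * C % 8 = 5)) ∨
      (A * B % 16 = 14 ∧ (A * C % 8 = 5 ∨ A * C % 8 = 7)) :=
    hr.imp_left fun hAB => ⟨by rw [hAB.1]; rfl, hAB.2⟩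
  have hdvd : 16 ∣ (A ^ 2 - 1) * B := by
    obtain ⟨β, -, rfl | ⟨rfl, -⟩⟩ := h.exists_oddPart
    · obtain ⟨j, hj⟩ := Int.eight_dvd_sq_sub_one_of_odd h.odd_left
      exact ⟨j * β, by linear_combination 2 * β * hj⟩
    · simp
  obtain ⟨⟨i, hi⟩, k, rfl⟩ := And.intro hdvd hW
  exact two_dvd_of_sixteen_dvd_norm_form hclass
    ⟨k ^ 2 + i * C * X₄ ^ 2, by linear_combination hX + C * X₄ ^ 2 * hi⟩

end Two

namespace Admissible

variable {A B C : ℤ} (h : Admissible A B C) {l : ℕ}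

include h

theorem S_subset_Zloc (hl : Ramified A B C l) : S (A * B) (A * C) ⊆ Zloc l := by
  intro s hs
  obtain ⟨X₁, X₂, X₃, X₄, W, hW0, rfl, hX, hprim⟩ := exists_primitive_of_mem_S hl.1.one_lt hs
  rcases eq_or_ne l 2 with rfl | h2
  · have hW4 : ¬ 4 ∣ W := fun hW => hprim ⟨h.two_dvd_of_norm_eq_sq hl.2 hX hW,
      (by norm_num : ((2 : ℕ) : ℤ) ∣ 4).trans hW⟩
    by_cases hW2 : 2 ∣ W
    · obtain ⟨V, rfl⟩ := hW2
      refine ⟨X₁, V, fun hV => hW4 (mul_dvd_mul_left 2 hV), ?_⟩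
      rw [Int.cast_mul, Int.cast_mul, mul_div_mul_left _ _ (by norm_num)]
    · exact ⟨2 * X₁, W, hW2, rfl⟩
  · exact ⟨2 * X₁, W, fun hW => hprim ⟨h.dvd_of_norm_eq_sq hl h2 hX hW, hW⟩, rfl⟩

end Admissible

lemma add_mem_Zloc {l : ℕ} (hl : l.Prime) {x y : ℚ} (hx : x ∈ Zloc l) (hy : y ∈ Zloc l) :
    x + y ∈ Zloc l := by
  rw [mem_Zloc_iff] at hx hy ⊢
  exact fun hd => (hl.dvd_mul.1 (hd.trans (Rat.add_den_dvd x y))).elim hx hy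

lemma Admissible.T_subset_Zloc {A B C : ℤ} (h : Admissible A B C) {l : ℕ}
    (hl : Ramified A B C l) : T (A * B) (A * C) ⊆ Zloc l := by
  rintro _ ⟨x, hx, y, hy, rfl⟩
  exact add_mem_Zloc hl.1 (h.S_subset_Zloc hl hx) (h.S_subset_Zloc hl hy)

section PartialFractions

lemma exists_mul_eq_of_prime_pred (P : ℕ → Prop) {n : ℕ} (hn : n ≠ 0) :
    ∃ α β : ℕ, n = α * β ∧ (∀ l, l.Prime → l ∣ α → P l) ∧ (∀ l, l.Prime → l ∣ β → ¬ P l) := by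
  induction n using induction_on_primes with
  | zero => exact absurd rfl hn
  | one => exact ⟨1, 1, rfl, fun l hl h => absurd h hl.not_dvd_one,
      fun l hl h => absurd h hl.not_dvd_one⟩
  | prime_mul p m hp ih =>
    obtain ⟨α, β, rfl, hα, hβ⟩ := ih (right_ne_zero_of_mul hn)
    have heq {l : ℕ} (hl : l.Prime) (h : l ∣ p) : l = p := (Nat.prime_dvd_prime_iff_eq hl hp).1 h
    by_cases hP : P p
    · exact ⟨p * α, β, (mul_assoc p α β).symm,
        fun l hl h => (hl.dvd_mul.1 h).elim (fun h => heq hl h ▸ hP) (hα l hl), hβ⟩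
    · exact ⟨α, p * β, mul_left_comm p α β, hα,
        fun l hl h => (hl.dvd_mul.1 h).elim (fun h => heq hl h ▸ hP) (hβ l hl)⟩

lemma exists_sub_mem_Zloc_of_prime_pred (P : ℕ → Prop) (x : ℚ) :
    ∃ y : ℚ, (∀ l, l.Prime → P l → y ∈ Zloc l) ∧ ∀ l, l.Prime → ¬ P l → x - y ∈ Zloc l := by
  obtain ⟨α, β, hαβ, hα, hβ⟩ := exists_mul_eq_of_prime_pred P x.den_nz
  obtain ⟨i, j, hij⟩ := Nat.isCoprime_iff_coprime.2
    (Nat.coprime_of_dvd fun l hl h1 h2 => hβ l hl h2 (hα l hl h1))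
  obtain ⟨hα0, hβ0⟩ : (α : ℚ) ≠ 0 ∧ (β : ℚ) ≠ 0 := by
    have := hαβ ▸ x.den_nz
    exact ⟨Nat.cast_ne_zero.2 (left_ne_zero_of_mul this),
      Nat.cast_ne_zero.2 (right_ne_zero_of_mul this)⟩
  refine ⟨(x.num * i : ℤ) / (β : ℤ), fun l hl hP => ⟨_, _, fun hd => ?_, rfl⟩,
    fun l hl hP => ⟨x.num * j, α, fun hd => ?_, ?_⟩⟩
  · exact hβ l hl (Int.natCast_dvd_natCast.1 hd) hP
  · exact hP (hα l hl (Int.natCast_dvd_natCast.1 hd))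
  · have hij' : (i : ℚ) * α + j * β = 1 := by exact_mod_cast hij
    have hx : x = x.num / (α * β) := by
      rw [← Nat.cast_mul, ← hαβ, Rat.num_div_den]
    rw [sub_eq_iff_eq_add]
    refine hx.trans ?_
    push_cast
    field_simp
    linear_combination -(x.num : ℚ) * hij'

end PartialFractions

lemma sub_mem_Zloc {l : ℕ} (hl : l.Prime) {x y : ℚ} (hx : x ∈ Zloc l) (hy : y ∈ Zloc l) :
    x - y ∈ Zloc l := by
  rw [sub_eq_add_neg]
  exact add_mem_Zloc hl hx (by rwa [mem_Zloc_iff, Rat.neg_den, ← mem_Zloc_iff])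

lemma intCast_mem_Zloc {l : ℕ} (hl : l.Prime) (n : ℤ) : (n : ℚ) ∈ Zloc l :=
  mem_Zloc_iff.2 hl.not_dvd_one

section Sumset

variable {A B C A' B' C' : ℤ} (h : Admissible A B C) (h' : Admissible A' B' C')

include h h'

/-- The summand in `T (AB) (AC)` is the fractional part of a partial fraction of `x`, which is small
enough for the real place. -/
lemma mem_T_add_T_of_mem_Zloc (hreal : ¬ RamifiedReal A' B' C') {x : ℚ}
    (hx : ∀ l, Ramified A B C l → Ramified A' B' C' l → x ∈ Zloc l) :
    x ∈ T (A * B) (A * C) + T (A' * B') (A' * C') := by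
  obtain ⟨y, hy, hxy⟩ := exists_sub_mem_Zloc_of_prime_pred (Ramified A B C) x
  have hfract {l : ℕ} (hl : l.Prime) (hyl : y ∈ Zloc l) : Int.fract y ∈ Zloc l :=
    sub_mem_Zloc hl hyl (intCast_mem_Zloc hl ⌊y⌋)
  refine Set.mem_add.2 ⟨Int.fract y, h.mem_T (fun l hl => hfract hl.1 (hy l hl.1 hl)) fun _ => ?_,
    x - Int.fract y, h'.mem_T (fun l hl => ?_) fun hr => absurd hr hreal, add_sub_cancel _ _⟩
  · rw [abs_of_nonneg (Int.fract_nonneg y)]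
    exact (Int.fract_lt_one y).le
  · by_cases hr : Ramified A B C l
    · exact sub_mem_Zloc hl.1 (hx l hr hl) (hfract hl.1 (hy l hl.1 hr))
    · rw [Int.fract, ← sub_add]
      exact add_mem_Zloc hl.1 (hxy l hl.1 hr) (intCast_mem_Zloc hl.1 ⌊y⌋)

theorem T_add_T_eq_iInter (hreal : ¬ (RamifiedReal A B C ∧ RamifiedReal A' B' C')) :
    T (A * B) (A * C) + T (A' * B') (A' * C') =
      ⋂ l ∈ {l | Ramified A B C l ∧ Ramified A' B' C' l}, Zloc l := by
  refine Set.Subset.antisymm (Set.subset_iInter₂ ?_) fun x hx => ?_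
  · rintro l ⟨hl, hl'⟩ _ ⟨y, hy, z, hz, rfl⟩
    exact add_mem_Zloc hl.1 (h.T_subset_Zloc hl hy) (h'.T_subset_Zloc hl' hz)
  · have hx (l : ℕ) (hl : Ramified A B C l) (hl' : Ramified A' B' C' l) : x ∈ Zloc l :=
      Set.mem_iInter₂.1 hx l ⟨hl, hl'⟩
    rcases not_and_or.1 hreal with hr | hr
    · rw [add_comm]
      exact mem_T_add_T_of_mem_Zloc h' h hr fun l hl' hl => hx l hl hl'
    · exact mem_T_add_T_of_mem_Zloc h h' hr hx

end Sumset

section Isomorphisms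

variable (a : ℚ)

lemma S_mul_self_left {b : ℚ} (hb : b ≠ 0) : S (a * b) b = S (-a) b := by
  ext s
  constructor
  · rintro ⟨x₁, x₂, x₃, x₄, h, rfl⟩
    exact ⟨x₁, b * x₄, x₃, x₂, by rw [← h]; ring, rfl⟩
  · rintro ⟨x₁, x₂, x₃, x₄, h, rfl⟩
    refine ⟨x₁, x₄, x₃, x₂ / b, ?_, rfl⟩
    rw [← h]
    field_simp
    ring

lemma T_mul_self_left {b : ℚ} (hb : b ≠ 0) : T (a * b) b = T (-a) b := by
  rw [T, S_mul_self_left a hb, T]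

lemma S_mul_sq_left (b : ℚ) {c : ℚ} (hc : c ≠ 0) : S (a * c ^ 2) b = S a b := by
  ext s
  constructor
  · rintro ⟨x₁, x₂, x₃, x₄, h, rfl⟩
    exact ⟨x₁, c * x₂, x₃, c * x₄, by rw [← h]; ring, rfl⟩
  · rintro ⟨x₁, x₂, x₃, x₄, h, rfl⟩
    refine ⟨x₁, x₂ / c, x₃, x₄ / c, ?_, rfl⟩
    rw [← h]
    field_simp

lemma S_mul_norm_right (b : ℚ) {u v : ℚ} (h : u ^ 2 - a * v ^ 2 ≠ 0) :
    S a (b * (u ^ 2 - a * v ^ 2)) = S a b := by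
  have hsub (b u v : ℚ) : S a (b * (u ^ 2 - a * v ^ 2)) ⊆ S a b := by
    rintro s ⟨x₁, x₂, x₃, x₄, h, rfl⟩
    exact ⟨x₁, x₂, u * x₃ + a * v * x₄, u * x₄ + v * x₃, by rw [← h]; ring, rfl⟩
  refine (hsub b u v).antisymm ?_
  obtain ⟨N, hN⟩ : ∃ N, N = u ^ 2 - a * v ^ 2 := ⟨_, rfl⟩
  rw [← hN] at h ⊢
  have hinv : b * N * ((u / N) ^ 2 - a * (v / N) ^ 2) = b := by
    field_simp
    rw [← hN]
  simpa only [hinv] using hsub (b * N) (u / N) (v / N)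

lemma S_mul_sq_right (b : ℚ) {c : ℚ} (hc : c ≠ 0) : S a (b * c ^ 2) = S a b := by
  simpa using S_mul_norm_right a b (u := c) (v := 0) (by simpa using hc)

end Isomorphisms

section SquarefreeKernel

variable {l : ℕ} {p f : ℚ} {c : ℤ}

lemma exists_squarefree_mul_sq_rat (hp : p ≠ 0) :
    ∃ (c : ℤ) (f : ℚ), p = c * f ^ 2 ∧ Squarefree c ∧ f ≠ 0 := by
  have hden : (p.den : ℤ) ≠ 0 := mod_cast p.den_nz
  obtain ⟨c, f, h, hc, hf⟩ := exists_squarefree_mul_sq (mul_ne_zero (Rat.num_ne_zero.2 hp) hden)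
  refine ⟨c, f / p.den, ?_, hc, div_ne_zero (mod_cast hf) (mod_cast p.den_nz)⟩
  have h' : (p.num : ℚ) * p.den = c * f ^ 2 := mod_cast h
  nth_rewrite 1 [← Rat.num_div_den p]
  field_simp
  linear_combination h'

lemma odd_padicValRat_iff (hl : l.Prime) (h : p = c * f ^ 2) (hc : Squarefree c) (hf : f ≠ 0) :
    Odd (padicValRat l p) ↔ (l : ℤ) ∣ c := by
  have : Fact l.Prime := ⟨hl⟩
  have hc0 : (c : ℚ) ≠ 0 := mod_cast hc.ne_zero
  rw [h, padicValRat.mul hc0 (pow_ne_zero 2 hf), padicValRat.pow, padicValRat.of_int]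
  by_cases hd : (l : ℤ) ∣ c
  · obtain ⟨c', rfl⟩ := hd
    have hc' : ¬ (l : ℤ) ∣ c' := not_dvd_of_squarefree_mul hc hl dvd_rfl
    have hv : padicValInt l (l * c') = 1 := by
      rw [padicValInt.mul (mod_cast hl.ne_zero) (by rintro rfl; simp at hc'),
        padicValInt.self hl.one_lt, padicValInt.eq_zero_of_not_dvd hc']
    simp [hv, parity_simps]
  · simp [padicValInt.eq_zero_of_not_dvd hd, hd]

lemma ModEqTwo.exists_eq_div_sq {k : ℕ} (hp : ModEqTwo k p) :
    ∃ w n : ℤ, n % 2 = 1 ∧ w % 8 = k % 8 ∧ p = w / n ^ 2 := by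
  obtain ⟨_, ⟨m, n, hn, rfl⟩, rfl⟩ := hp
  have hn2 : n % 2 = 1 := by push_cast at hn; omega
  have hn0 : (n : ℚ) ≠ 0 := mod_cast show n ≠ 0 by omega
  refine ⟨k * n ^ 2 + 8 * (m * n), n, hn2, ?_, ?_⟩
  · rw [Int.add_mul_emod_self_left, Int.mul_emod, sq_emod_eight hn2, mul_one, Int.emod_emod]
  · push_cast
    field_simp

lemma emod_eight_of_modEqTwo {k : ℕ} (hk : Odd k) (h : p = c * f ^ 2) (hc : Squarefree c)
    (hp : ModEqTwo k p) : c % 8 = k % 8 := by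
  obtain ⟨w, n, hn, hw, hpw⟩ := hp.exists_eq_div_sq
  have hn0 : (n : ℚ) ≠ 0 := mod_cast show n ≠ 0 by omega
  have hfin : FiniteMultiplicity (2 : ℤ) f.den :=
    Int.finiteMultiplicity_iff.2 ⟨by norm_num, mod_cast f.den_nz⟩
  obtain ⟨e, he, he2⟩ := hfin.exists_eq_pow_mul_and_not_dvd
  generalize multiplicity (2 : ℤ) (f.den : ℤ) = j at he
  have heq : c * (n * f.num) ^ 2 = (2 ^ j) ^ 2 * (w * e ^ 2) := by
    have hwden : (c : ℚ) * (n * f.num) ^ 2 = w * f.den ^ 2 := by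
      rw [h, eq_div_iff (pow_ne_zero 2 hn0), ← Rat.num_div_den f] at hpw
      field_simp at hpw
      linear_combination hpw
    have hwden : c * (n * f.num) ^ 2 = w * (f.den : ℤ) ^ 2 := mod_cast hwden
    rw [hwden, he]
    ring
  obtain ⟨g, hg⟩ := exists_mul_sq_eq_of_mul_sq_eq Nat.prime_two hc heq
  have hwe : w * e ^ 2 % 8 = k % 8 := by
    rw [Int.mul_emod, sq_emod_eight (by omega), mul_one, Int.emod_emod, hw]
  have hk2 := Nat.odd_iff.1 hk
  have hg2 : g % 2 = 1 := by
    by_contra hg2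
    obtain ⟨i, rfl⟩ : ∃ i, g = 2 * i := ⟨g / 2, by omega⟩
    have : c * (2 * i) ^ 2 = 4 * (c * i ^ 2) := by ring
    omega
  rw [← hwe, ← hg, Int.mul_emod, sq_emod_eight hg2, mul_one, Int.emod_emod]

lemma modEqTwo_natCast {k p : ℕ} (h : p ≡ k [MOD 8]) : ModEqTwo k (p : ℚ) := by
  obtain ⟨z, hz⟩ := Nat.modEq_iff_dvd.1 h.symm
  refine ⟨z, intCast_mem_Zloc Nat.prime_two z, ?_⟩
  have hz' : (p : ℚ) - k = 8 * z := mod_cast hz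
  linear_combination hz'

lemma oddPrimes_natCast {p : ℕ} (hp : p.Prime) : oddPrimes (p : ℚ) = {p} := by
  ext l
  rw [Set.mem_singleton_iff]
  have hval (hl : l.Prime) : Odd (padicValRat l (p : ℚ)) ↔ l = p := by
    rw [odd_padicValRat_iff hl (f := 1) (c := p) (by simp)
      (Nat.prime_iff_prime_int.1 hp).squarefree one_ne_zero, Int.natCast_dvd_natCast,
      Nat.prime_dvd_prime_iff_eq hl hp]
  exact ⟨fun h => (hval h.1).1 h.2, fun h => ⟨h ▸ hp, (hval (h ▸ hp)).2 h⟩⟩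

end SquarefreeKernel

section Legendre

variable {l : ℕ}

lemma exists_eq_zpow_padicValRat_mul_div (hl : l.Prime) {h : ℚ} (hh : h ≠ 0) :
    ∃ c d : ℤ, ¬ (l : ℤ) ∣ c ∧ ¬ (l : ℤ) ∣ d ∧ h = (l : ℚ) ^ padicValRat l h * (c / d) := by
  have hfin {n : ℤ} (hn : n ≠ 0) : FiniteMultiplicity (l : ℤ) n :=
    Int.finiteMultiplicity_iff.2 ⟨hl.ne_one, hn⟩
  obtain ⟨c, hnum, hc⟩ := (hfin (Rat.num_ne_zero.2 hh)).exists_eq_pow_mul_and_not_dvd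
  obtain ⟨d, hden, hd⟩ := (hfin (n := h.den) (mod_cast h.den_nz)).exists_eq_pow_mul_and_not_dvd
  refine ⟨c, d, hc, hd, ?_⟩
  have hnum' : (h.num : ℚ) = l ^ multiplicity (l : ℤ) h.num * c := mod_cast hnum
  have hden' : (h.den : ℚ) = l ^ multiplicity (l : ℤ) h.den * d := mod_cast hden
  rw [padicValRat.multiplicity_sub_multiplicity hl.ne_one hh, ← Int.natCast_multiplicity,
    zpow_sub₀ (mod_cast hl.ne_zero), zpow_natCast, zpow_natCast, div_mul_div_comm, ← hnum',
    ← hden', Rat.num_div_den]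

lemma exists_mul_div_sq_eq_sq_add_iff (hl : l.Prime) {n c d : ℤ} (hc : ¬ (l : ℤ) ∣ c)
    (hd : ¬ (l : ℤ) ∣ d) :
    (∃ y : ℤ, ∃ z ∈ Zloc l, (n : ℚ) * (c / d) ^ 2 = (y : ℚ) ^ 2 + (l : ℚ) * z) ↔
      IsSquare (n : ZMod l) := by
  have : Fact l.Prime := ⟨hl⟩
  have hcast {x : ℤ} (hx : ¬ (l : ℤ) ∣ x) : (x : ZMod l) ≠ 0 :=
    mt (ZMod.intCast_zmod_eq_zero_iff_dvd _ _).1 hx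
  have hrat {x : ℤ} (hx : ¬ (l : ℤ) ∣ x) : (x : ℚ) ≠ 0 := by
    rintro h
    simp [Int.cast_eq_zero.1 h] at hx
  have hc0 := hcast hc
  have hd0 := hcast hd
  have hdq := hrat hd
  constructor
  · rintro ⟨y, _, ⟨m, m', hm', rfl⟩, hz⟩
    have hmq := hrat hm'
    have hclear : n * c ^ 2 * m' = (y * d) ^ 2 * m' + l * (m * d ^ 2) := by
      field_simp at hz
      have : (n : ℚ) * c ^ 2 * m' = (y * d) ^ 2 * m' + l * (m * d ^ 2) := by
        linear_combination hz
      exact_mod_cast this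
    have hmod := congrArg (Int.cast : ℤ → ZMod l) hclear
    push_cast at hmod
    rw [ZMod.natCast_self, zero_mul, add_zero] at hmod
    refine ⟨y * d / c, ?_⟩
    field_simp
    linear_combination mul_right_cancel₀ (hcast hm') hmod
  · rintro ⟨r, hr⟩
    obtain ⟨y, hy⟩ := ZMod.intCast_surjective (r * (c : ZMod l) / (d : ZMod l))
    obtain ⟨k, hk⟩ : (l : ℤ) ∣ n * c ^ 2 - (y * d) ^ 2 := by
      rw [← ZMod.intCast_zmod_eq_zero_iff_dvd]
      push_cast
      rw [hy, hr]
      field_simp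
      ring
    have hk' : (n : ℚ) * c ^ 2 - (y * d) ^ 2 = l * k := mod_cast hk
    refine ⟨y, k / (d ^ 2 : ℤ),
      ⟨k, d ^ 2, fun h => hd ((Nat.prime_iff_prime_int.1 hl).dvd_of_dvd_pow h), rfl⟩, ?_⟩
    push_cast
    field_simp
    linear_combination hk'

lemma genLegendre_eq_neg_one_iff (hl : l.Prime) {a h : ℚ} {n : ℤ} (ha : a = n * h ^ 2)
    (hh : h ≠ 0) (hn : ¬ (l : ℤ) ∣ n) : genLegendre a l = -1 ↔ jacobiSym n l = -1 := by
  have : Fact l.Prime := ⟨hl⟩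
  have hl0 : (l : ℚ) ≠ 0 := mod_cast hl.ne_zero
  have hn0 : (n : ℚ) ≠ 0 := by
    rintro h
    simp [Int.cast_eq_zero.1 h] at hn
  obtain ⟨c, d, hc, hd, hcd⟩ := exists_eq_zpow_padicValRat_mul_div hl hh
  have hv : padicValRat l a = 2 * padicValRat l h := by
    rw [ha, padicValRat.mul hn0 (pow_ne_zero 2 hh), padicValRat.pow, padicValRat.of_int,
      padicValInt.eq_zero_of_not_dvd hn]
    simp
  have hunit : a * (l : ℚ) ^ (-padicValRat l a) = n * (c / d) ^ 2 := by
    rw [hv, ha, zpow_neg, mul_comm 2, zpow_mul, ← div_eq_mul_inv, zpow_ofNat]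
    nth_rewrite 1 [hcd]
    field_simp
  rw [jacobiSym_eq_neg_one_iff hl, ← exists_mul_div_sq_eq_sq_add_iff hl hc hd, genLegendre, hunit]
  split_ifs with hsq <;> simp [hsq]

end Legendre

section OneParameter

lemma not_dvd_of_eq_neg_one_or_two {m : ℤ} (hm : m = -1 ∨ m = 2 ∨ m = -2) {l : ℕ}
    (hl : l.Prime) (hl2 : l ≠ 2) : ¬ (l : ℤ) ∣ m := by
  have h2 := not_dvd_two_of_prime hl hl2
  rcases hm with rfl | rfl | rfl
  · rw [dvd_neg]
    exact (Nat.prime_iff_prime_int.1 hl).not_dvd_one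
  · exact h2
  · rwa [dvd_neg]

lemma admissible_one {m : ℤ} (hm : m = -1 ∨ m = 2 ∨ m = -2) {C : ℤ} (hC : Squarefree C)
    (hodd : Odd C) : Admissible 1 m C := by
  refine ⟨one_pos, ?_, odd_one, hodd, by rcases hm with rfl | rfl | rfl <;> simp⟩
  have h2C : IsRelPrime 2 C := (Int.isCoprime_two_left.2 hodd).isRelPrime
  rw [one_mul]
  rcases hm with rfl | rfl | rfl
  · exact hC.squarefree_of_dvd (by simp)
  · exact squarefree_mul_iff.2 ⟨h2C, Int.prime_two.squarefree, hC⟩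
  · exact (squarefree_mul_iff.2 ⟨h2C, Int.prime_two.squarefree, hC⟩).squarefree_of_dvd (by simp)

lemma ramified_one_iff {m : ℤ} (hm : m = -1 ∨ m = 2 ∨ m = -2) {C : ℤ} {l : ℕ}
    (hl : l.Prime) (hl2 : l ≠ 2) :
    Ramified 1 m C l ↔ (l : ℤ) ∣ C ∧ jacobiSym m l = -1 := by
  have hl1 := (Nat.prime_iff_prime_int.1 hl).not_dvd_one
  have hlm := not_dvd_of_eq_neg_one_or_two hm hl hl2
  simp only [Ramified, hl, hl2, localSymbol, hl1, hlm, if_false, true_and, one_mul]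
  split_ifs with hlC <;> simp [hlC]

lemma S_mul_two {m : ℤ} (hm : m = -1 ∨ m = 2 ∨ m = -2) (c : ℚ) : S m (c * 2) = S m c := by
  obtain ⟨u, v, huv⟩ : ∃ u v : ℚ, u ^ 2 - m * v ^ 2 = 2 := by
    rcases hm with rfl | rfl | rfl
    exacts [⟨1, 1, by norm_num⟩, ⟨2, 1, by norm_num⟩, ⟨0, 1, by norm_num⟩]
  rw [← huv]
  exact S_mul_norm_right _ c (huv ▸ two_ne_zero)

/-- The odd squarefree integer `c` represents the rational number `p` modulo squares and powers
of `2`. -/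
structure IsOddKernel (c : ℤ) (p : ℚ) : Prop where
  squarefree : Squarefree c
  odd : Odd c
  exists_eq : ∃ f : ℚ, f ≠ 0 ∧ (p = c * f ^ 2 ∨ p = (2 * c : ℤ) * f ^ 2)

lemma exists_isOddKernel {p : ℚ} (hp : p ≠ 0) : ∃ c, IsOddKernel c p := by
  obtain ⟨c, f, h, hc, hf⟩ := exists_squarefree_mul_sq_rat hp
  rcases Int.even_or_odd' c with ⟨c, rfl | rfl⟩
  · refine ⟨c, hc.squarefree_of_dvd (dvd_mul_left _ _), ?_, f, hf, Or.inr h⟩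
    have := not_dvd_of_squarefree_mul (l := 2) hc Nat.prime_two (by simp)
    rw [Int.odd_iff]
    push_cast at this
    omega
  · exact ⟨_, hc, odd_two_mul_add_one c, f, hf, Or.inl h⟩

namespace IsOddKernel

variable {c : ℤ} {p : ℚ} (h : IsOddKernel c p)
include h

lemma squarefree_two_mul : Squarefree (2 * c) :=
  squarefree_mul_iff.2
    ⟨(Int.isCoprime_two_left.2 h.odd).isRelPrime, Int.prime_two.squarefree, h.squarefree⟩

lemma odd_padicValRat_iff {l : ℕ} (hl : l.Prime) (hl2 : l ≠ 2) :
    Odd (padicValRat l p) ↔ (l : ℤ) ∣ c := by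
  obtain ⟨f, hf, hp | hp⟩ := h.exists_eq
  · exact LocalRings.odd_padicValRat_iff hl hp h.squarefree hf
  · rw [LocalRings.odd_padicValRat_iff hl hp h.squarefree_two_mul hf,
      (Nat.prime_iff_prime_int.1 hl).dvd_mul, or_iff_right (not_dvd_two_of_prime hl hl2)]

lemma emod_eight {k : ℕ} (hk : Odd k) (hp : ModEqTwo k p) : c % 8 = k % 8 := by
  obtain ⟨f, -, hf | hf⟩ := h.exists_eq
  · exact emod_eight_of_modEqTwo hk hf h.squarefree hp
  · have := emod_eight_of_modEqTwo hk hf h.squarefree_two_mul hp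
    have := Nat.odd_iff.1 hk
    omega

lemma T_mul_eq {m : ℤ} (hm : m = -1 ∨ m = 2 ∨ m = -2) (s : ℚ) : T m (s * p) = T m (s * c) := by
  suffices S m (s * p) = S m (s * c) by rw [T, T, this]
  obtain ⟨f, hf, rfl | rfl⟩ := h.exists_eq
  · rw [← mul_assoc, S_mul_sq_right _ _ hf]
  · rw [← mul_assoc, S_mul_sq_right _ _ hf, ← S_mul_two hm (s * c)]
    push_cast
    congr 1
    ring

end IsOddKernel

/-- The quaternion algebras `(m₁, s₁p)` and `(m₂, s₂p)` are never both ramified at the real place,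
their common ramified primes `l ≠ 2` are exactly the `l ≡ k mod 8` with `v_l(p)` odd, and `2` is not
a common ramified prime when `p ≡₂ k mod 8`. -/
structure CutsOutResidueClass (k : ℕ) (m₁ m₂ : ℤ) (s₁ s₂ : ℤˣ) : Prop where
  odd : Odd k
  left : m₁ = -1 ∨ m₁ = 2 ∨ m₁ = -2
  right : m₂ = -1 ∨ m₂ = 2 ∨ m₂ = -2
  jacobiSym_iff : ∀ l : ℕ, Odd l → (jacobiSym m₁ l = -1 ∧ jacobiSym m₂ l = -1 ↔ l ≡ k [MOD 8])
  not_ramifiedTwo : ∀ c : ℤ, c % 8 = k % 8 →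
    ¬ (RamifiedTwo 1 m₁ (s₁ * c) ∧ RamifiedTwo 1 m₂ (s₂ * c))
  not_ramifiedReal : ∀ c : ℤ, ¬ (RamifiedReal 1 m₁ (s₁ * c) ∧ RamifiedReal 1 m₂ (s₂ * c))

lemma eq_or_eq_union_two {X Y : Set ℕ} (h : ∀ l, l ≠ 2 → (l ∈ X ↔ l ∈ Y)) (hY : 2 ∉ Y) :
    X = Y ∨ 2 ∈ X ∧ X = Y ∪ {2} := by
  by_cases hX : 2 ∈ X
  · refine Or.inr ⟨hX, Set.ext fun l => ?_⟩
    rcases eq_or_ne l 2 with rfl | hl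
    · simp [hX]
    · simp [h l hl, hl]
  · refine Or.inl (Set.ext fun l => ?_)
    rcases eq_or_ne l 2 with rfl | hl
    · simp [hX, hY]
    · exact h l hl

namespace CutsOutResidueClass

variable {k : ℕ} {m₁ m₂ : ℤ} {s₁ s₂ : ℤˣ} (h : CutsOutResidueClass k m₁ m₂ s₁ s₂)
include h

lemma ramified_iff_mem_oddPrimesMod {c : ℤ} {p : ℚ} (hc : IsOddKernel c p) {l : ℕ} (hl2 : l ≠ 2) :
    Ramified 1 m₁ (s₁ * c) l ∧ Ramified 1 m₂ (s₂ * c) l ↔ l ∈ oddPrimesMod k p := by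
  by_cases hl : l.Prime
  · rw [ramified_one_iff h.left hl hl2, ramified_one_iff h.right hl hl2, Units.dvd_mul_left,
      Units.dvd_mul_left, ← and_and_left, h.jacobiSym_iff l (hl.odd_of_ne_two hl2),
      ← hc.odd_padicValRat_iff hl hl2]
    simp only [oddPrimesMod, oddPrimes, Set.mem_ofPred_eq, hl, true_and]
  · simp [Ramified, oddPrimesMod, oddPrimes, hl]

lemma two_notMem_oddPrimesMod (p : ℚ) : 2 ∉ oddPrimesMod k p := by
  rintro ⟨-, h2 : 2 % 8 = k % 8⟩
  have := Nat.odd_iff.1 h.odd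
  omega

lemma T_add_T_eq {c : ℤ} {p : ℚ} (hc : IsOddKernel c p) :
    T m₁ ((s₁ : ℤ) * p) + T m₂ ((s₂ : ℤ) * p) =
      ⋂ l ∈ {l | Ramified 1 m₁ (s₁ * c) l ∧ Ramified 1 m₂ (s₂ * c) l}, Zloc l := by
  have hadm {m : ℤ} (hm : m = -1 ∨ m = 2 ∨ m = -2) (s : ℤˣ) : Admissible 1 m (s * c) :=
    admissible_one hm (hc.squarefree.squarefree_of_dvd (Units.mul_left_dvd.2 dvd_rfl))
      (Int.odd_mul.2 ⟨by rcases Int.units_eq_one_or s with rfl | rfl <;> decide, hc.odd⟩)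
  rw [← T_add_T_eq_iInter (hadm h.left s₁) (hadm h.right s₂) (h.not_ramifiedReal c),
    hc.T_mul_eq h.left, hc.T_mul_eq h.right]
  push_cast
  simp only [one_mul]

theorem eq_iInter_or {p : ℚ} (hp : p ≠ 0) :
    T m₁ ((s₁ : ℤ) * p) + T m₂ ((s₂ : ℤ) * p) = (⋂ l ∈ oddPrimesMod k p, Zloc l) ∨
      ¬ ModEqTwo k p ∧ T m₁ ((s₁ : ℤ) * p) + T m₂ ((s₂ : ℤ) * p) =
        ⋂ l ∈ oddPrimesMod k p ∪ {2}, Zloc l := by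
  obtain ⟨c, hc⟩ := exists_isOddKernel hp
  rw [h.T_add_T_eq hc]
  rcases eq_or_eq_union_two (fun l hl2 => h.ramified_iff_mem_oddPrimesMod hc hl2)
    (h.two_notMem_oddPrimesMod p) with heq | ⟨⟨hr₁, hr₂⟩, heq⟩
  · exact Or.inl (by rw [← heq]; rfl)
  · refine Or.inr ⟨fun hpk => ?_, by rw [← heq]; rfl⟩
    exact h.not_ramifiedTwo c (hc.emod_eight h.odd hpk) ⟨hr₁.2, hr₂.2⟩

end CutsOutResidueClass

end OneParameter

section ResidueClasses

variable {l : ℕ}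

lemma jacobiSym_neg_one_and_two_eq_neg_one_iff (hl : Odd l) :
    jacobiSym (-1) l = -1 ∧ jacobiSym 2 l = -1 ↔ l ≡ 3 [MOD 8] := by
  have hl2 := Nat.odd_iff.1 hl
  rw [jacobiSym.at_neg_one hl, jacobiSym.at_two hl, ZMod.χ₄_nat_eq_if_mod_four,
    ZMod.χ₈_nat_eq_if_mod_eight, Nat.ModEq]
  split_ifs <;> simp <;> omega

lemma jacobiSym_neg_two_and_two_eq_neg_one_iff (hl : Odd l) :
    jacobiSym (-2) l = -1 ∧ jacobiSym 2 l = -1 ↔ l ≡ 5 [MOD 8] := by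
  have hl2 := Nat.odd_iff.1 hl
  rw [jacobiSym.at_neg_two hl, jacobiSym.at_two hl, ZMod.χ₈'_nat_eq_if_mod_eight,
    ZMod.χ₈_nat_eq_if_mod_eight, Nat.ModEq]
  split_ifs <;> simp <;> omega

lemma jacobiSym_neg_one_and_neg_two_eq_neg_one_iff (hl : Odd l) :
    jacobiSym (-1) l = -1 ∧ jacobiSym (-2) l = -1 ↔ l ≡ 7 [MOD 8] := by
  have hl2 := Nat.odd_iff.1 hl
  rw [jacobiSym.at_neg_one hl, jacobiSym.at_neg_two hl, ZMod.χ₄_nat_eq_if_mod_four,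
    ZMod.χ₈'_nat_eq_if_mod_eight, Nat.ModEq]
  split_ifs <;> simp <;> omega

lemma cutsOutResidueClass_three : CutsOutResidueClass 3 (-1) 2 (-1) (-1) where
  odd := by decide
  left := by simp
  right := by simp
  jacobiSym_iff _ := jacobiSym_neg_one_and_two_eq_neg_one_iff
  not_ramifiedTwo c hc := by
    simp only [RamifiedTwo, Units.val_neg, Units.val_one]
    omega
  not_ramifiedReal c := by
    simp only [RamifiedReal]
    omega

lemma cutsOutResidueClass_five : CutsOutResidueClass 5 (-2) 2 (-1) (-1) where
  odd := by decide
  left := by simp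
  right := by simp
  jacobiSym_iff _ := jacobiSym_neg_two_and_two_eq_neg_one_iff
  not_ramifiedTwo c hc := by
    simp only [RamifiedTwo, Units.val_neg, Units.val_one]
    omega
  not_ramifiedReal c := by
    simp only [RamifiedReal]
    omega

lemma cutsOutResidueClass_seven : CutsOutResidueClass 7 (-1) (-2) (-1) 1 where
  odd := by decide
  left := by simp
  right := by simp
  jacobiSym_iff _ := jacobiSym_neg_one_and_neg_two_eq_neg_one_iff
  not_ramifiedTwo c hc := by
    simp only [RamifiedTwo, Units.val_neg, Units.val_one]
    omega
  not_ramifiedReal c := by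
    simp only [RamifiedReal, Units.val_neg, Units.val_one]
    omega

lemma R3_eq {p : ℚ} (hp : p ≠ 0) : R3 p = T (-1) (-p) + T 2 (-p) := by
  simpa [R3] using congrArg₂ (· + ·) (T_mul_self_left 1 (neg_ne_zero.2 hp))
    (T_mul_self_left (-2) (neg_ne_zero.2 hp))

lemma R5_eq {p : ℚ} (hp : p ≠ 0) : R5 p = T (-2) (-p) + T 2 (-p) := by
  simpa [R5] using congrArg₂ (· + ·) (T_mul_self_left 2 (neg_ne_zero.2 hp))
    (T_mul_self_left (-2) (neg_ne_zero.2 hp))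

lemma R7_eq {p : ℚ} (hp : p ≠ 0) : R7 p = T (-1) (-p) + T (-2) p := by
  simpa [R7] using congrArg₂ (· + ·) (T_mul_self_left 1 (neg_ne_zero.2 hp)) (T_mul_self_left 2 hp)

lemma R1_eq (p : ℚ) {q : ℚ} (hq : q ≠ 0) : R1 p q = T (2 * p) q + T (-2 * p) q := by
  rw [add_comm]
  simpa [R1] using congrArg₂ (· + ·) (T_mul_self_left (2 * p) hq) (T_mul_self_left (-2 * p) hq)

theorem R_eq_iInter_or {k : ℕ} {R : ℚ → Set ℚ}
    (h : (k = 3 ∧ R = R3) ∨ (k = 5 ∧ R = R5) ∨ (k = 7 ∧ R = R7)) {p : ℚ} (hp : p ≠ 0) :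
    R p = (⋂ l ∈ oddPrimesMod k p, Zloc l) ∨
      ¬ ModEqTwo k p ∧ R p = ⋂ l ∈ oddPrimesMod k p ∪ {2}, Zloc l := by
  rcases h with ⟨rfl, rfl⟩ | ⟨rfl, rfl⟩ | ⟨rfl, rfl⟩
  · simpa [R3_eq hp] using cutsOutResidueClass_three.eq_iInter_or hp
  · simpa [R5_eq hp] using cutsOutResidueClass_five.eq_iInter_or hp
  · simpa [R7_eq hp] using cutsOutResidueClass_seven.eq_iInter_or hp

lemma oddPrimesMod_natCast {k p : ℕ} (hp : p.Prime) (hpk : p ≡ k [MOD 8]) :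
    oddPrimesMod k (p : ℚ) = {p} := by
  ext l
  simp only [oddPrimesMod, oddPrimes_natCast hp, Set.mem_ofPred_eq, Set.mem_singleton_iff]
  exact ⟨And.left, fun h => ⟨h, h ▸ hpk⟩⟩

theorem Zloc_two_eq : Zloc 2 = T 3 3 + T 2 5 := by
  have h3 : Admissible 1 (-1) 3 :=
    admissible_one (by simp) Int.prime_three.squarefree (by decide)
  have h5 : Admissible 1 2 5 :=
    admissible_one (by simp) (Nat.prime_iff_prime_int.1 Nat.prime_five).squarefree (by decide)
  have hset : {l | Ramified 1 (-1) 3 l ∧ Ramified 1 2 5 l} = {2} := by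
    ext l
    refine ⟨fun ⟨hr₁, hr₂⟩ => ?_, ?_⟩
    · by_contra hl2 : l ≠ 2
      have hl := hr₁.1
      have hd₁ : l ∣ 3 := mod_cast ((ramified_one_iff (by simp) hl hl2).1 hr₁).1
      have hd₂ : l ∣ 5 := mod_cast ((ramified_one_iff (by simp) hl hl2).1 hr₂).1
      exact hl.not_dvd_one (by simpa using Nat.dvd_gcd hd₁ hd₂)
    · rintro rfl
      exact ⟨⟨Nat.prime_two, by decide⟩, ⟨Nat.prime_two, by decide⟩⟩
  have hT : T 3 3 = T (-1) 3 := by simpa using T_mul_self_left 1 (three_ne_zero' ℚ)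
  have hsum := T_add_T_eq_iInter h3 h5 (by simp [RamifiedReal])
  rw [hset] at hsum
  simpa [hT] using hsum.symm

end ResidueClasses

section TwoParameters

variable {g p q ε : ℤ}

lemma exists_eq_mul_isCoprime (hp : p ≠ 0) (q : ℤ) :
    ∃ g p' q' : ℤ, 0 < g ∧ p = g * p' ∧ q = g * q' ∧ IsCoprime p' q' := by
  have hg : 0 < Int.gcd p q := Int.gcd_pos_of_ne_zero_left q hp
  obtain ⟨p', q', hcop, hp', hq'⟩ := Int.exists_gcd_one hg
  exact ⟨Int.gcd p q, p', q', mod_cast hg, by rwa [mul_comm], by rwa [mul_comm],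
    Int.isCoprime_iff_gcd_eq_one.2 hcop⟩

lemma admissible_two_mul (hg : 0 < g) (hp : Squarefree (g * p)) (hq : Squarefree (g * q))
    (hpq : IsCoprime p q) (hp8 : g * p % 8 = 1) (hqo : Odd (g * q)) (hε : ε = 2 ∨ ε = -2) :
    Admissible g (ε * p) q where
  pos := hg
  squarefree := by
    have hpo : Odd (g * p) := Int.odd_iff.2 (by omega)
    obtain ⟨hgq, -, hq'⟩ := squarefree_mul_iff.1 hq
    have hsq : Squarefree (2 * (g * p * q)) := squarefree_mul_iff.2
      ⟨(Int.isCoprime_two_left.2 (hpo.mul (Int.odd_mul.1 hqo).2)).isRelPrime,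
        Int.prime_two.squarefree,
        squarefree_mul_iff.2 ⟨IsRelPrime.mul_left hgq hpq.isRelPrime, hp, hq'⟩⟩
    refine hsq.squarefree_of_dvd ?_
    rcases hε with rfl | rfl
    · exact ⟨1, by ring⟩
    · exact ⟨-1, by ring⟩
  odd_left := (Int.odd_mul.1 hqo).1
  odd_right := (Int.odd_mul.1 hqo).2
  middle := by
    rw [mul_left_comm]
    rcases hε with rfl | rfl <;> omega

lemma ramified_two_mul_iff (hpq : IsCoprime p q) (hε : ε = 2 ∨ ε = -2) {l : ℕ} (hl : l.Prime)
    (hl2 : l ≠ 2) :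
    Ramified g (ε * p) q l ↔
      ((l : ℤ) ∣ g * p ∧ ¬ (l : ℤ) ∣ g * q ∧ jacobiSym (g * q) l = -1) ∨
      ((l : ℤ) ∣ g * q ∧ ¬ (l : ℤ) ∣ g * p ∧ jacobiSym (ε * (g * p)) l = -1) ∨
      ((l : ℤ) ∣ g ∧ jacobiSym (-ε * (p * q)) l = -1) := by
  have hli := Nat.prime_iff_prime_int.1 hl
  have hlε (x : ℤ) : (l : ℤ) ∣ ε * x ↔ (l : ℤ) ∣ x := by
    rw [hli.dvd_mul, or_iff_right (not_dvd_of_eq_neg_one_or_two (Or.inr hε) hl hl2)]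
  have hlpq (hlp : (l : ℤ) ∣ p) : ¬ (l : ℤ) ∣ q := fun hlq =>
    hli.not_isUnit (hpq.isUnit_of_dvd' hlp hlq)
  simp only [Ramified, hl, hl2, localSymbol, hlε, if_false, true_and]
  by_cases hlg : (l : ℤ) ∣ g
  · simp only [hlg, hlg.mul_right, if_true, not_true, false_and, and_false, true_and, false_or]
    rw [neg_mul, mul_assoc]
  · simp only [hli.dvd_mul, hlg, false_or, if_false, false_and, or_false]
    by_cases hlp : (l : ℤ) ∣ p
    · simp [hlp, hlpq hlp]
    · simp only [hlp, if_false, false_and, false_or, not_false_iff, true_and, mul_left_comm g]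
      split_ifs with hlq <;> simp [hlq]

lemma mem_primesPQ_iff {x y f h : ℚ} (hx : x = (g * p : ℤ) * f ^ 2) (hf : f ≠ 0)
    (hy : y = (g * q : ℤ) * h ^ 2) (hh : h ≠ 0) (hp : Squarefree (g * p))
    (hq : Squarefree (g * q)) (hpq : IsCoprime p q) {l : ℕ} (hl : l.Prime) (hl2 : l ≠ 2) :
    l ∈ primesPQ x y ↔
      ((l : ℤ) ∣ g * p ∧ ¬ (l : ℤ) ∣ g * q ∧ jacobiSym (g * q) l = -1) ∨
      ((l : ℤ) ∣ g * q ∧ ¬ (l : ℤ) ∣ g * p ∧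
        jacobiSym (2 * (g * p)) l = -1 ∧ jacobiSym (-2 * (g * p)) l = -1) ∨
      ((l : ℤ) ∣ g ∧ jacobiSym (2 * (p * q)) l = -1 ∧ jacobiSym (-2 * (p * q)) l = -1) := by
  have hli := Nat.prime_iff_prime_int.1 hl
  have hg0 : (g : ℚ) ≠ 0 := mod_cast left_ne_zero_of_mul hp.ne_zero
  have hnd {ε n : ℤ} (hε : ε = 2 ∨ ε = -2) (hn : ¬ (l : ℤ) ∣ n) : ¬ (l : ℤ) ∣ ε * n := by
    rw [hli.dvd_mul, or_iff_right (not_dvd_of_eq_neg_one_or_two (Or.inr hε) hl hl2)]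
    exact hn
  have hdvd : (l : ℤ) ∣ g * p ∧ (l : ℤ) ∣ g * q ↔ (l : ℤ) ∣ g := by
    rw [hli.dvd_mul, hli.dvd_mul, ← or_and_left, or_iff_left]
    exact fun hd => hli.not_isUnit (hpq.isUnit_of_dvd' hd.1 hd.2)
  simp only [primesPQ, oddPrimes, Set.mem_ofPred_eq, Set.mem_sdiff, Set.mem_inter_iff, hl, true_and,
    odd_padicValRat_iff hl hx hp hf, odd_padicValRat_iff hl hy hq hh, and_assoc]
  refine or_congr ?_ (or_congr ?_ ?_)
  · refine and_congr_right fun _ => and_congr_right fun hn => ?_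
    rw [genLegendre_eq_neg_one_iff hl hy hh hn]
  · refine and_congr_right fun _ => and_congr_right fun hn => ?_
    rw [genLegendre_eq_neg_one_iff hl (n := 2 * (g * p)) (by rw [hx]; push_cast; ring) hf
      (hnd (Or.inl rfl) hn), genLegendre_eq_neg_one_iff hl (n := -2 * (g * p))
      (by rw [hx]; push_cast; ring) hf (hnd (Or.inr rfl) hn)]
  · rw [← and_assoc, hdvd]
    refine and_congr_right fun hlg => ?_
    have hn : ¬ (l : ℤ) ∣ p * q := hli.not_dvd_mul (not_dvd_of_squarefree_mul hp hl hlg)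
      (not_dvd_of_squarefree_mul hq hl hlg)
    have hgfh : g * f * h ≠ 0 := mul_ne_zero (mul_ne_zero hg0 hf) hh
    rw [genLegendre_eq_neg_one_iff hl (n := 2 * (p * q)) (by rw [hx, hy]; push_cast; ring) hgfh
      (hnd (Or.inl rfl) hn), genLegendre_eq_neg_one_iff hl (n := -2 * (p * q))
      (by rw [hx, hy]; push_cast; ring) hgfh (hnd (Or.inr rfl) hn)]

lemma ramified_and_ramified_iff_mem_primesPQ {x y f h : ℚ} (hx : x = (g * p : ℤ) * f ^ 2)
    (hf : f ≠ 0) (hy : y = (g * q : ℤ) * h ^ 2) (hh : h ≠ 0) (hp : Squarefree (g * p))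
    (hq : Squarefree (g * q)) (hpq : IsCoprime p q) (hp8 : g * p % 8 = 1) (hq8 : g * q % 8 = 3)
    (l : ℕ) : Ramified g (2 * p) q l ∧ Ramified g (-2 * p) q l ↔ l ∈ primesPQ x y := by
  by_cases hl : l.Prime
  · rcases eq_or_ne l 2 with rfl | hl2
    · have hx2 : ¬ Odd (padicValRat 2 x) := by
        rw [odd_padicValRat_iff hl hx hp hf]
        push_cast
        omega
      have hy2 : ¬ Odd (padicValRat 2 y) := by
        rw [odd_padicValRat_iff hl hy hq hh]
        push_cast
        omega
      have hr : ¬ RamifiedTwo g (-(2 * p)) q := by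
        rw [RamifiedTwo, mul_neg, mul_left_comm]
        omega
      simp [Ramified, primesPQ, oddPrimes, hx2, hy2, hr]
    · rw [mem_primesPQ_iff hx hf hy hh hp hq hpq hl hl2,
        ramified_two_mul_iff hpq (Or.inl rfl) hl hl2, ramified_two_mul_iff hpq (Or.inr rfl) hl hl2,
        neg_neg]
      have hgp (hlg : (l : ℤ) ∣ g) : (l : ℤ) ∣ g * p := hlg.mul_right p
      have hgq (hlg : (l : ℤ) ∣ g) : (l : ℤ) ∣ g * q := hlg.mul_right q
      tauto
  · simp [Ramified, primesPQ, oddPrimes, hl]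

theorem R1_eq_iInter {x y : ℚ} (hx0 : x ≠ 0) (hy0 : y ≠ 0) (hx1 : ModEqTwo 1 x)
    (hy3 : ModEqTwo 3 y) : R1 x y = ⋂ l ∈ primesPQ x y, Zloc l := by
  obtain ⟨a, f, hx, ha, hf⟩ := exists_squarefree_mul_sq_rat hx0
  obtain ⟨b, h, hy, hb, hh⟩ := exists_squarefree_mul_sq_rat hy0
  have ha8 : a % 8 = 1 := emod_eight_of_modEqTwo odd_one hx ha hx1
  have hb8 : b % 8 = 3 := emod_eight_of_modEqTwo (by decide) hy hb hy3
  obtain ⟨g, p, q, hg, rfl, rfl, hpq⟩ := exists_eq_mul_isCoprime ha.ne_zero b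
  have hadm {ε : ℤ} (hε : ε = 2 ∨ ε = -2) : Admissible g (ε * p) q :=
    admissible_two_mul hg ha hb hpq ha8 (Int.odd_iff.2 (by omega)) hε
  have hreal : ¬ (RamifiedReal g (2 * p) q ∧ RamifiedReal g (-2 * p) q) := by
    simp only [RamifiedReal, mul_left_comm g]
    omega
  have hT (ε : ℤ) : T (ε * x) y = T (g * (ε * p : ℤ)) (g * q) := by
    suffices S (ε * x) y = S (g * (ε * p : ℤ)) (g * q) by rw [T, this, T]
    rw [hy, S_mul_sq_right _ _ hh, ← S_mul_sq_left (g * (ε * p : ℤ)) _ hf, hx]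
    push_cast
    congr 1
    ring
  have hR : R1 x y = T (g * (2 * p : ℤ)) (g * q) + T (g * (-2 * p : ℤ)) (g * q) := by
    rw [← hT, ← hT, R1_eq x hy0]
    push_cast
    rfl
  rw [hR, T_add_T_eq_iInter (hadm (Or.inl rfl)) (hadm (Or.inr rfl)) hreal]
  exact congrArg (⋂ l ∈ ·, Zloc l) (Set.ext
    (ramified_and_ramified_iff_mem_primesPQ hx hf hy hh ha hb hpq ha8 hb8))

lemma primesPQ_natCast {p q : ℕ} [hp : Fact p.Prime] [hq : Fact q.Prime] (hp1 : p ≡ 1 [MOD 8])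
    (hq3 : q ≡ 3 [MOD 8]) (h : legendreSym q (p : ℤ) = -1) : primesPQ (p : ℚ) (q : ℚ) = {p} := by
  have hp8 : p % 8 = 1 := hp1
  have hq8 : q % 8 = 3 := hq3
  have hpq : p ≠ q := by omega
  have hqo : Odd q := Nat.odd_iff.2 (by omega)
  have hqi := Nat.prime_iff_prime_int.1 hq.out
  rw [jacobiSym.legendreSym.to_jacobiSym] at h
  have hqp : genLegendre q p = -1 := by
    rw [genLegendre_eq_neg_one_iff hp.out (n := q) (h := 1) (by simp) one_ne_zero,
      ← jacobiSym.quadratic_reciprocity_one_mod_four (a := p) (by omega) hqo]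
    · exact h
    · rwa [Int.natCast_dvd_natCast, Nat.prime_dvd_prime_iff_eq hp.out hq.out]
  have hpq2 : genLegendre (2 * p) q ≠ -1 := by
    rw [Ne, genLegendre_eq_neg_one_iff hq.out (n := 2 * p) (h := 1) (by simp) one_ne_zero,
      jacobiSym.mul_left, h, jacobiSym.at_two hqo, ZMod.χ₈_nat_eq_if_mod_eight,
      if_neg (by omega), if_neg (by omega)]
    · decide
    · refine hqi.not_dvd_mul (not_dvd_two_of_prime hq.out (by omega)) ?_
      rwa [Int.natCast_dvd_natCast, Nat.prime_dvd_prime_iff_eq hq.out hp.out, eq_comm]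
  ext l
  simp only [primesPQ, Set.mem_ofPred_eq, oddPrimes_natCast hp.out, oddPrimes_natCast hq.out,
    Set.mem_sdiff, Set.mem_inter_iff, Set.mem_singleton_iff]
  refine ⟨?_, ?_⟩
  · rintro (⟨⟨rfl, -⟩, -⟩ | ⟨⟨rfl, -⟩, h2, -⟩ | ⟨⟨rfl, -⟩, -⟩)
    exacts [rfl, absurd h2 hpq2, rfl]
  · rintro rfl
    exact Or.inl ⟨⟨rfl, hpq⟩, hqp⟩

end TwoParameters

end LocalRings

theorem mainTheorem8 :
    -- part (a)
    (LocalRings.Zloc 2 = LocalRings.T 3 3 + LocalRings.T 2 5) ∧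
    -- part (b), for each pair of k and the corresponding ring
    (∀ (k : ℕ) (R : ℚ → Set ℚ),
      (k = 3 ∧ R = LocalRings.R3) ∨ (k = 5 ∧ R = LocalRings.R5) ∨ (k = 7 ∧ R = LocalRings.R7) →
      (∀ p : ℚ, p ≠ 0 →
        (LocalRings.ModEqTwo k p →
          R p = ⋂ l ∈ LocalRings.oddPrimesMod k p, LocalRings.Zloc l) ∧
        (¬ LocalRings.ModEqTwo k p →
          R p = (⋂ l ∈ LocalRings.oddPrimesMod k p, LocalRings.Zloc l) ∨
          R p = ⋂ l ∈ LocalRings.oddPrimesMod k p ∪ {2}, LocalRings.Zloc l)) ∧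
      (∀ p : ℕ, p.Prime → p ≡ k [MOD 8] → LocalRings.Zloc p = R (p : ℚ))) ∧
    -- part (c)
    (∀ p q : ℚ, p ≠ 0 → q ≠ 0 → LocalRings.ModEqTwo 1 p → LocalRings.ModEqTwo 3 q →
      ((LocalRings.primesPQ p q).Nonempty →
        LocalRings.R1 p q = ⋂ l ∈ LocalRings.primesPQ p q, LocalRings.Zloc l) ∧
      (LocalRings.primesPQ p q = ∅ → LocalRings.R1 p q = Set.univ)) ∧
    (∀ (p q : ℕ) [Fact p.Prime] [Fact q.Prime], p ≡ 1 [MOD 8] → q ≡ 3 [MOD 8] →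
      legendreSym q (p : ℤ) = -1 → LocalRings.Zloc p = LocalRings.R1 (p : ℚ) (q : ℚ)) := by
  refine ⟨LocalRings.Zloc_two_eq, fun k R hkR => ⟨fun p hp => ?_, fun p hp hpk => ?_⟩,
    fun p q hp hq hp1 hq3 => ⟨fun _ => LocalRings.R1_eq_iInter hp hq hp1 hq3, fun h => ?_⟩,
    fun p q hp hq hp1 hq3 h => ?_⟩
  · rcases LocalRings.R_eq_iInter_or hkR hp with hR | ⟨hpk, hR⟩
    · exact ⟨fun _ => hR, fun _ => .inl hR⟩
    · exact ⟨fun h => absurd h hpk, fun _ => .inr hR⟩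
  · rcases LocalRings.R_eq_iInter_or hkR (p := p) (mod_cast hp.ne_zero) with hR | ⟨hn, -⟩
    · rw [hR, LocalRings.oddPrimesMod_natCast hp hpk, Set.biInter_singleton]
    · exact absurd (LocalRings.modEqTwo_natCast hpk) hn
  · rw [LocalRings.R1_eq_iInter hp hq hp1 hq3, h, Set.biInter_empty]
  · rw [LocalRings.R1_eq_iInter (mod_cast hp.out.ne_zero) (mod_cast hq.out.ne_zero)
      (LocalRings.modEqTwo_natCast hp1) (LocalRings.modEqTwo_natCast hq3),
      LocalRings.primesPQ_natCast hp1 hq3 h, Set.biInter_singleton]
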